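/- Let $n\ge 8$, $p\in[1,2]$, $\frac1p+\frac1q=1$ (so $q\in[2,\infty]$), and $\rho_n=\min\{q-1,\,16\ln n-8\}\,n^{\frac2q-1}$. Let $d:\mathbb R^n\to\mathbb R$ be a prox-function, i.e. differentiable and $1$-strongly convex with respect to $\|\cdot\|_p$: $d(y)-d(x)-\langle\nabla d(x),y-x\rangle\ge\frac12\|y-x\|_p^2$ for all $x,y$; let $V[z](x)=d(x)-d(z)-\langle\nabla d(z),x-z\rangle$. (Admissible choices are $d(x)=\frac{\mathrm e\, n^{(\kappa-1)(2-\kappa)/\kappa}\ln n}{2}\|x\|_\kappa^2$ with $\kappa=1+\frac1{\ln n}$ for $p=1$, and $d(x)=\frac12\|x\|_2^2$ for $p=2$; that these are prox-functions is part of the claim.) Let $\xi$ be a random element with distribution $P$, let $f(x)=\mathbb E_\xi F(x,\xi)$ be convex on $\mathbb R^n$ with a minimizer $x^*$, and let, for $P$-almost every $\xi$, $F(\cdot,\xi)$ have a gradient $g(\cdot,\xi)$ that is $L(\xi)$-Lipschitz in the Euclidean norm, with $0<L_2:=\sqrt{\mathbb E_\xi L(\xi)^2}<\infty$ and $\mathbb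 E_\xi\|g(x,\xi)-\nabla f(x)\|_2^2\le\sigma^2$ for all $x$. One oracle call at a pair $(x,y)$ returns $(\widetilde f(x,\xi),\widetilde f(y,\xi))$ for a realization $\xi$, where $\widetilde f=F+\eta$ and, almost surely in $\xi$, $|\eta(x,\xi)|\le\Delta$ for all $x$. RDFDS, started at $x_0$, with step size $\alpha=\frac{1}{48n\rho_nL_2}$, performs for $k=0,\dots,N-1$ the step $$x_{k+1}=\mathop{\arg\min}_{x\in\mathbb R^n}\Big\{\alpha n\Big\langle \frac1m\sum_{i=1}^m\frac{\widetilde f(x_k+te_{k+1},\xi_{k+1,i})-\widetilde f(x_k,\xi_{k+1,i})}{t}\,e_{k+1},\;x-x_k\Big\rangle+V[x_k](x)\Big\},$$ where $e_{k+1}$ is uniform on the unit Euclidean sphere, $\xi_{k+1,i}\sim P$, and all these variables are independent; it returns $\bar x_N=\frac1N\sum_{k=0}^{N-1}x_k$. Let $\Theta_p=V[x_0](x^*)$ and $\varepsilon>0$. There is a universal constant $c_0>0$ such that for every $C\ge c_0$ there is a constant $c_1>0$, depending only on $C$, such that the following holds for all data as above. Let the integers $N,m\ge1$ satisfy $$c_0\,\frac{n\rho_nL_2\Theta_p}{\varepsilon}\le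 N\le C\max\Big\{1,\frac{n\rho_nL_2\Theta_p}{\varepsilon}\Big\},\qquad c_0\,\frac{\sigma^2}{\varepsilon L_2}\le m\le C\max\Big\{1,\frac{\sigma^2}{\varepsilon L_2}\Big\},$$ and let $0<\Delta\le c_1\min\big\{\frac{\varepsilon}{n},\frac{\varepsilon^2}{nL_2\Theta_p}\big\}$ and $t=2\sqrt{\Delta/L_2}$ (the second entries of the minima are $+\infty$ if $\Theta_p=0$). Then $t\le C\min\big\{\sqrt{\frac{\varepsilon}{nL_2}},\frac{\varepsilon}{\sqrt{nL_2^2\Theta_p}}\big\}$, $$\mathbb E f(\bar x_N)-f(x^*)\le\varepsilon,$$ and the total number of oracle calls is $Nm\le C^2\max\{1,\frac{n\rho_nL_2\Theta_p}{\varepsilon}\}\max\{1,\frac{\sigma^2}{\varepsilon L_2}\}$. In particular, if $\varepsilon\le n\rho_nL_2\Theta_p$, then $$Nm\le C^2\max\Big\{\frac{n\rho_nL_2\Theta_p}{\varepsilon},\frac{n\rho_n\sigma^2\Theta_p}{\varepsilon^2}\Big\},$$ and if moreover $p=1$, then the number of oracle calls depends on the dimension, for given $\Theta_1$, only through a logarithm: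 $$Nm\le 16\,C^2\max\Big\{\frac{L_2\Theta_1\ln n}{\varepsilon},\frac{\sigma^2\Theta_1\ln n}{\varepsilon^2}\Big\}.$$ -/

import Mathlib

open MeasureTheory ProbabilityTheory

noncomputable section

namespace ZerothOrder

/-- `ℝⁿ` with the Euclidean norm and inner product. -/
abbrev Vec (n : ℕ) := EuclideanSpace ℝ (Fin n)

/-- The norm `‖x‖_p = (∑ i, |x i| ^ p) ^ (1 / p)` on `ℝⁿ`. -/
def lpNorm {n : ℕ} (p : ℝ) (x : Vec n) : ℝ :=
  (∑ i, |x i| ^ p) ^ (1 / p)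

/-- A prox-function: a differentiable function on `ℝⁿ` that is `1`-strongly convex with respect
to `‖·‖_p` (in particular it is continuous and convex). -/
structure IsProxFunction {n : ℕ} (p : ℝ) (d : Vec n → ℝ) : Prop where
  differentiable : Differentiable ℝ d
  strongly_convex : ∀ x y : Vec n,
    1 / 2 * lpNorm p (y - x) ^ 2 ≤ d y - d x - inner ℝ (gradient d x) (y - x)

/-- The Bregman divergence `V[z](x)` of `d`. -/
def bregman {n : ℕ} (d : Vec n → ℝ) (z x : Vec n) : ℝ :=
  d x - d z - inner ℝ (gradient d z) (x - z)

/-- The exponent `κ = 1 + 1 / ln n`. -/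
def kappa (n : ℕ) : ℝ := 1 + 1 / Real.log n

/-- The prox-function chosen for `p = 1`. -/
def proxOne (n : ℕ) (x : Vec n) : ℝ :=
  Real.exp 1 * (n : ℝ) ^ ((kappa n - 1) * (2 - kappa n) / kappa n) * Real.log n / 2
    * lpNorm (kappa n) x ^ 2

/-- The prox-function chosen for `p = 2`. -/
def proxTwo (n : ℕ) (x : Vec n) : ℝ := 1 / 2 * ‖x‖ ^ 2

/-- `ρ_n = min {q - 1, 16 ln n - 8} * n ^ (2 / q - 1)` with `1 / p + 1 / q = 1`.
Here `1 / q = 1 - 1 / p`, and `q = p / (p - 1)` for `p > 1`. For `p = 1` one has `q = ∞`,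
so that the minimum is its second entry. -/
def rho (p : ℝ) (n : ℕ) : ℝ :=
  (if p = 1 then 16 * Real.log n - 8 else min (p / (p - 1) - 1) (16 * Real.log n - 8))
    * (n : ℝ) ^ (2 * (1 - 1 / p) - 1)

/-- The uniform probability distribution on the unit Euclidean sphere of `ℝⁿ`, as a measure on
`ℝⁿ`: the normalized surface measure. -/
def sphereUniform (n : ℕ) : Measure (Vec n) :=
  (((volume : Measure (Vec n)).toSphere Set.univ)⁻¹ •
    (volume : Measure (Vec n)).toSphere).map Subtype.val

section Problem

variable {𝒳 : Type*} [MeasurableSpace 𝒳] {n : ℕ}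

/-- The objective `f(x) = E_ξ F(x, ξ)`, where `ξ` has distribution `P`. -/
def objective (P : Measure 𝒳) (F : Vec n → 𝒳 → ℝ) (x : Vec n) : ℝ := ∫ ξ, F x ξ ∂P

/-- The constant `L₂ = (E_ξ L(ξ)²) ^ (1 / 2)`. -/
def smoothConst (P : Measure 𝒳) (L : 𝒳 → ℝ) : ℝ := √(∫ ξ, L ξ ^ 2 ∂P)

/-- The assumptions on the stochastic optimization problem `min_x E_ξ F(x, ξ)`. The stochastic
gradient `g(x, ξ)` is the gradient of `F(·, ξ)` at `x`. -/
structure IsSmoothStochasticProblem (P : Measure 𝒳) (F : Vec n → 𝒳 → ℝ) (L : 𝒳 → ℝ) (σ : ℝ) :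
    Prop where
  measurable : Measurable (Function.uncurry F)
  integrable : ∀ x, Integrable (F x) P
  convex : ConvexOn ℝ Set.univ (objective P F)
  differentiable : ∀ᵐ ξ ∂P, Differentiable ℝ fun x => F x ξ
  lipschitz : ∀ᵐ ξ ∂P, ∀ x y,
    ‖gradient (fun u => F u ξ) x - gradient (fun u => F u ξ) y‖ ≤ L ξ * ‖x - y‖
  memLp : MemLp L 2 P
  variance_integrable : ∀ x, Integrable
    (fun ξ => ‖gradient (fun u => F u ξ) x - gradient (objective P F) x‖ ^ 2) P
  variance_le : ∀ x,
    ∫ ξ, ‖gradient (fun u => F u ξ) x - gradient (objective P F) x‖ ^ 2 ∂P ≤ σ ^ 2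

/-- `η` is an admissible noise of level `Δ`: `|η(x, ξ)| ≤ Δ` for all `x`, almost surely in `ξ`. -/
structure IsBoundedNoise (P : Measure 𝒳) (η : Vec n → 𝒳 → ℝ) (Δ : ℝ) : Prop where
  measurable : Measurable (Function.uncurry η)
  bound : ∀ᵐ ξ ∂P, ∀ x, |η x ξ| ≤ Δ

/-- One call of the two-point oracle at `(x + t e, x)` with realization `ξ`: the resulting finite
difference along `e`, together with its cost, one oracle call. Here `fn x ξ` is the noisy
value at `x`. -/
def oracleDiff (fn : Vec n → 𝒳 → ℝ) (t : ℝ) (x e : Vec n) (ξ : 𝒳) : Vec n × ℕ :=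
  (((fn (x + t • e) ξ - fn x ξ) / t) • e, 1)

/-- The mini-batch approximation of the gradient at `x`, together with the number of oracle calls
spent on it. -/
def gradEst (fn : Vec n → 𝒳 → ℝ) (t : ℝ) {m : ℕ} (x e : Vec n) (ξ : Fin m → 𝒳) : Vec n × ℕ :=
  let s := ∑ i, oracleDiff fn t x e (ξ i)
  ((1 / (m : ℝ)) • s.1, s.2)

/-- A global minimizer of `φ` (an arbitrary point if there is none). -/
def argminPt (φ : Vec n → ℝ) : Vec n :=
  Classical.epsilon fun x => ∀ y, φ x ≤ φ y

/-- The Randomized Derivative-Free Directional Search: the point `x_k` after `k` iterations,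
started at `x₀`, with prox-function `d`, step size `α` and smoothing parameter `t`, together
with the number of oracle calls made so far. In iteration `k` it uses the direction `e k` and the
batch of realizations `ξ k`. -/
def rdfds (d : Vec n → ℝ) (fn : Vec n → 𝒳 → ℝ) (α t : ℝ) {m : ℕ} (e : ℕ → Vec n)
    (ξ : ℕ → Fin m → 𝒳) (x₀ : Vec n) : ℕ → Vec n × ℕ
  | 0 => (x₀, 0)
  | k + 1 =>
    let s := rdfds d fn α t e ξ x₀ k
    let g := gradEst fn t s.1 (e k) (ξ k)
    (argminPt fun u => α * n * inner ℝ g.1 (u - s.1) + bregman d s.1 u, s.2 + g.2)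

/-- The output `(1 / N) ∑_{k < N} x_k` of the method after `N` iterations. -/
def rdfdsOutput (d : Vec n → ℝ) (fn : Vec n → 𝒳 → ℝ) (α t : ℝ) {m : ℕ} (e : ℕ → Vec n)
    (ξ : ℕ → Fin m → 𝒳) (x₀ : Vec n) (N : ℕ) : Vec n :=
  (1 / (N : ℝ)) • ∑ k ∈ Finset.range N, (rdfds d fn α t e ξ x₀ k).1

/-- The random input of the method on a probability space `(Ω, μ)`: in every iteration, `e k` is
uniformly distributed on the unit sphere, `ξ k 0, …, ξ k (m - 1)` have distribution `P`, these
`m + 1` variables are independent, and the iterations are independent of each other. -/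
structure IsSampling {Ω : Type*} [MeasurableSpace Ω] (μ : Measure Ω) (P : Measure 𝒳)
    [SigmaFinite P] {m : ℕ} (e : ℕ → Ω → Vec n) (ξ : ℕ → Ω → Fin m → 𝒳) : Prop where
  law : ∀ k, HasLaw (fun ω => (e k ω, ξ k ω))
    ((sphereUniform n).prod (Measure.pi fun _ : Fin m => P)) μ
  indep : iIndepFun (fun k ω => (e k ω, ξ k ω)) μ

end Problem

end ZerothOrder

end

open ZerothOrder

/-
One step of mirror descent with the estimate `n s e`, where `s` is the batch finite difference
along `e`, changes the Bregman divergence to the minimizer `x*` by at most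
`-α n s ⟨e, x - x*⟩ + (α n s ‖e‖_q)² / 2`. Up to an error of order `√(Δ L₂)`, `s` is `⟨g, e⟩` for
the batch gradient `g`. Averaging over `e` turns the linear term into `-α ⟨∇f(x), x - x*⟩`, and by
the symmetry of the sphere under coordinate permutations and sign changes
`E ⟨g, e⟩² ‖e‖_q² = |g|² E ‖e‖_q² / n`, where `E ‖e‖_q² ≤ 4 ρ_n` follows by comparing the sphere
with a Gaussian vector (and with `q` cut off at `2 ln n`). Since `|∇f(x)|² ≤ 4 L₂ (f(x) - f(x*))`,
the quadratic term is dominated by the linear one up to the variance of the batch. The linear effect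
of the error is not controlled uniformly in `x`; Young's inequality with parameter `1 / (α N)` moves
it into a factor `1 + 1 / N` on the divergence, which over `N` steps costs only
`(1 + 1 / N) ^ N ≤ 3`. The recursion for the expected divergence is run in `[0, ∞]`, so it needs no
prior integrability and in fact yields it.

For `p = 1`, the strong convexity of the squared `κ`-norm is checked on its smooth approximations,
in which `|u|` is replaced by `√(u² + δ²)`, letting `δ → 0`.
-/

noncomputable section

namespace ZerothOrder

section LpNorm

variable {n : ℕ} {p : ℝ}

lemma lpNorm_nonneg (p : ℝ) (x : Vec n) : 0 ≤ lpNorm p x := by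
  unfold lpNorm; positivity

lemma lpNorm_rpow (hp : p ≠ 0) (x : Vec n) : lpNorm p x ^ p = ∑ i, |x i| ^ p := by
  rw [lpNorm, one_div, Real.rpow_inv_rpow (by positivity) hp]

lemma lpNorm_sq (p : ℝ) (x : Vec n) : lpNorm p x ^ 2 = (∑ i, |x i| ^ p) ^ (2 / p) := by
  rw [lpNorm, ← Real.rpow_mul_natCast (by positivity)]
  congr 1
  push_cast; ring

lemma lpNorm_smul (hp : p ≠ 0) (c : ℝ) (x : Vec n) : lpNorm p (c • x) = |c| * lpNorm p x := by
  simp_rw [lpNorm, PiLp.smul_apply, smul_eq_mul, abs_mul,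
    Real.mul_rpow (abs_nonneg _) (abs_nonneg _), ← Finset.mul_sum]
  rw [Real.mul_rpow (by positivity) (by positivity), one_div,
    Real.rpow_rpow_inv (abs_nonneg c) hp]

lemma lpNorm_two (x : Vec n) : lpNorm 2 x = ‖x‖ := by
  simp [lpNorm, EuclideanSpace.norm_eq, Real.sqrt_eq_rpow]

lemma continuous_lpNorm (hp : 0 < p) : Continuous (lpNorm p : Vec n → ℝ) := by
  refine .rpow_const (continuous_finsetSum _ fun i _ => ?_) fun x => Or.inr (by positivity)
  exact .rpow_const (by fun_prop) fun x => Or.inr hp.le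

lemma abs_apply_le_lpNorm (hp : 0 < p) (x : Vec n) (i : Fin n) : |x i| ≤ lpNorm p x := by
  rw [← Real.rpow_le_rpow_iff (abs_nonneg _) (lpNorm_nonneg p x) hp, lpNorm_rpow hp.ne']
  exact Finset.single_le_sum (f := fun i => |x i| ^ p) (fun j _ => by positivity)
    (Finset.mem_univ i)

lemma lpNorm_anti {q : ℝ} (hp : 0 < p) (hpq : p ≤ q) (x : Vec n) : lpNorm q x ≤ lpNorm p x := by
  have hq : 0 < q := hp.trans_le hpq
  have split (a : ℝ) (ha : 0 ≤ a) : a ^ q = a ^ p * a ^ (q - p) := by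
    rw [← Real.rpow_add_of_nonneg ha hp.le (sub_nonneg.2 hpq), add_sub_cancel]
  rw [← Real.rpow_le_rpow_iff (lpNorm_nonneg q x) (lpNorm_nonneg p x) hq]
  calc lpNorm q x ^ q = ∑ i, |x i| ^ p * |x i| ^ (q - p) := by
        simp_rw [lpNorm_rpow hq.ne', split _ (abs_nonneg _)]
    _ ≤ ∑ i, |x i| ^ p * lpNorm p x ^ (q - p) := by
        gcongr with i
        exact abs_apply_le_lpNorm hp x i
    _ = lpNorm p x ^ q := by
        rw [← Finset.sum_mul, ← lpNorm_rpow hp.ne', ← split _ (lpNorm_nonneg p x)]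

lemma norm_le_lpNorm (hp : 0 < p) (hp2 : p ≤ 2) (x : Vec n) : ‖x‖ ≤ lpNorm p x :=
  lpNorm_two x ▸ lpNorm_anti hp hp2 x

lemma inner_le_lpNorm_mul_lpNorm {q : ℝ} (hpq : p.HolderConjugate q) (x y : Vec n) :
    inner ℝ x y ≤ lpNorm p x * lpNorm q y := by
  simpa [PiLp.inner_apply, mul_comm, lpNorm] using
    Real.inner_le_Lp_mul_Lq Finset.univ x.ofLp y.ofLp hpq

lemma lpNorm_one_le (hp : 1 < p) (x : Vec n) :
    lpNorm 1 x ≤ (n : ℝ) ^ (1 - 1 / p) * lpNorm p x := by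
  have hpq : p.HolderConjugate (p / (p - 1)) := .conjExponent hp
  have h := Real.inner_le_Lp_mul_Lq Finset.univ (fun i => |x i|) (fun _ => 1) hpq
  simp only [abs_abs, abs_one, Real.one_rpow, Finset.sum_const, Finset.card_univ,
    Fintype.card_fin, nsmul_eq_mul, mul_one] at h
  rw [mul_comm, one_div, hpq.one_sub_inv, ← one_div]
  simpa [lpNorm] using h

end LpNorm

section Gaussian

variable (E : Type*) [NormedAddCommGroup E] [InnerProductSpace ℝ E] [FiniteDimensional ℝ E]
  [MeasurableSpace E] [BorelSpace E]

lemma stdGaussian_eq_withDensity : stdGaussian E = volume.withDensity fun x => ENNReal.ofReal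
    ((2 * Real.pi) ^ (-(Module.finrank ℝ E / 2 : ℝ)) * Real.exp (-‖x‖ ^ 2 / 2)) := by
  set c : ℝ := (2 * Real.pi) ^ (-(Module.finrank ℝ E / 2 : ℝ)) with hc
  have : 0 < c := by positivity
  have hρ : Measurable fun x : E => ENNReal.ofReal (c * Real.exp (-‖x‖ ^ 2 / 2)) := by fun_prop
  have hc1 : (c : ℂ) * (Real.pi / (1 / 2 : ℂ)) ^ (Module.finrank ℝ E / 2 : ℂ) = 1 := by
    have : (Real.pi / (1 / 2 : ℂ)) ^ (Module.finrank ℝ E / 2 : ℂ)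
        = ((2 * Real.pi : ℝ) ^ (Module.finrank ℝ E / 2 : ℝ) : ℝ) := by
      rw [Complex.ofReal_cpow (by positivity)]
      push_cast
      congr 1
      ring
    rw [this, ← Complex.ofReal_mul, hc, ← Real.rpow_add (by positivity)]
    simp
  have hexp : Integrable fun x : E => Real.exp (-‖x‖ ^ 2 / 2) := by
    have h := (GaussianFourier.integrable_cexp_neg_mul_sq_norm_add (V := E) (b := 1 / 2)
      (by simp) 0 0).re
    refine h.congr (ae_of_all _ fun x => ?_)
    have : -(1 / 2 : ℂ) * (‖x‖ : ℂ) ^ 2 + 0 * (inner ℝ 0 x : ℝ) = ((-‖x‖ ^ 2 / 2 : ℝ) : ℂ) := by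
      push_cast; ring
    simp only [this, RCLike.re_eq_complex_re, Complex.exp_ofReal_re]
  have : IsFiniteMeasure (volume.withDensity fun x : E =>
      ENNReal.ofReal (c * Real.exp (-‖x‖ ^ 2 / 2))) :=
    isFiniteMeasure_withDensity_ofReal (hexp.const_mul c).2
  refine Measure.ext_of_charFun (funext fun t => ?_)
  rw [charFun_stdGaussian, charFun_apply,
    integral_withDensity_eq_integral_toReal_smul hρ (by simp)]
  calc Complex.exp (-‖t‖ ^ 2 / 2)
      = c * ∫ x : E, Complex.exp (-(1 / 2 : ℂ) * ‖x‖ ^ 2 + Complex.I * inner ℝ t x) := by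
        rw [GaussianFourier.integral_cexp_neg_mul_sq_norm_add (by simp), ← mul_assoc, hc1, one_mul,
          Complex.I_sq]
        congr 1
        ring
    _ = _ := by
        rw [← integral_const_mul]
        congr with x
        rw [ENNReal.toReal_ofReal (by positivity), Complex.real_smul, Complex.ofReal_mul,
          Complex.ofReal_exp, mul_assoc, ← Complex.exp_add, real_inner_comm]
        push_cast
        congr 2
        ring

end Gaussian

section Polar

variable {E : Type*} [NormedAddCommGroup E] [NormedSpace ℝ E] [FiniteDimensional ℝ E]
  [Nontrivial E] [MeasurableSpace E] [BorelSpace E]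

lemma integral_normalize_mul_norm_addHaar (μ : Measure E) [μ.IsAddHaarMeasure] (ψ : E → ℝ)
    (g : ℝ → ℝ) : ∫ x, ψ (‖x‖⁻¹ • x) * g ‖x‖ ∂μ
      = (⨍ u : Metric.sphere (0 : E) 1, ψ u ∂μ.toSphere) * ∫ x, g ‖x‖ ∂μ := by
  have polar (ψ : E → ℝ) : ∫ x, ψ (‖x‖⁻¹ • x) * g ‖x‖ ∂μ
      = (∫ u : Metric.sphere (0 : E) 1, ψ u ∂μ.toSphere) *
        ∫ r : Set.Ioi (0 : ℝ), g r ∂Measure.volumeIoiPow (Module.finrank ℝ E - 1) := by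
    calc ∫ x, ψ (‖x‖⁻¹ • x) * g ‖x‖ ∂μ
        = ∫ x : ({0}ᶜ : Set E), ψ (‖x.1‖⁻¹ • x.1) * g ‖x.1‖ ∂μ.comap (↑) := by
          rw [integral_subtype_comap (measurableSet_singleton _).compl
            fun x => ψ (‖x‖⁻¹ • x) * g ‖x‖, restrict_compl_singleton]
      _ = ∫ z, ψ z.1 * g z.2 ∂μ.toSphere.prod (.volumeIoiPow (Module.finrank ℝ E - 1)) := by
          simpa using μ.measurePreserving_homeomorphUnitSphereProd.integral_comp
            (Homeomorph.measurableEmbedding _) fun z => ψ z.1 * g z.2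
      _ = _ := integral_prod_mul (fun u : Metric.sphere (0 : E) 1 => ψ u)
          fun r : Set.Ioi (0 : ℝ) => g r
  have hS : μ.toSphere.real Set.univ ≠ 0 :=
    ENNReal.toReal_ne_zero.2
      ⟨Measure.measure_univ_ne_zero.2 (Measure.toSphere_ne_zero μ), measure_ne_top _ _⟩
  have h1 := polar fun _ => 1
  simp only [one_mul, integral_const, smul_eq_mul, mul_one] at h1
  rw [polar, h1, average_eq, smul_eq_mul]
  field_simp

end Polar

section Sphere

variable {n : ℕ}

instance isProbabilityMeasure_sphereUniform [NeZero n] :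
    IsProbabilityMeasure (sphereUniform n) :=
  have : IsProbabilityMeasure (((volume : Measure (Vec n)).toSphere Set.univ)⁻¹ •
      (volume : Measure (Vec n)).toSphere) :=
    have : NeZero (volume : Measure (Vec n)).toSphere := ⟨Measure.toSphere_ne_zero _⟩
    isProbabilityMeasureSMul
  Measure.isProbabilityMeasure_map measurable_subtype_coe.aemeasurable

lemma ae_norm_eq_one_sphereUniform : ∀ᵐ e ∂(sphereUniform n), ‖e‖ = 1 := by
  rw [sphereUniform, ae_map_iff measurable_subtype_coe.aemeasurable
    (measurableSet_eq_fun measurable_norm measurable_const)]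
  exact ae_of_all _ fun x => by simp

lemma integrable_sphereUniform_of_continuous [NeZero n] {φ : Vec n → ℝ} (hφ : Continuous φ) :
    Integrable φ (sphereUniform n) := by
  obtain ⟨C, hC⟩ := (isCompact_sphere (0 : Vec n) 1).exists_bound_of_continuousOn hφ.continuousOn
  refine .of_bound hφ.aestronglyMeasurable C ?_
  filter_upwards [ae_norm_eq_one_sphereUniform] with e he using hC e (by simpa using he)

lemma integral_sphereUniform (ψ : Vec n → ℝ) : ∫ e, ψ e ∂(sphereUniform n)
    = ⨍ u : Metric.sphere (0 : Vec n) 1, ψ u ∂(volume : Measure (Vec n)).toSphere := by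
  rw [sphereUniform, (MeasurableEmbedding.subtype_coe
    Metric.isClosed_sphere.measurableSet).integral_map, average]

lemma integral_normalize_mul_norm_stdGaussian [NeZero n] (ψ : Vec n → ℝ) (g : ℝ → ℝ) :
    ∫ x, ψ (‖x‖⁻¹ • x) * g ‖x‖ ∂stdGaussian (Vec n)
      = (∫ e, ψ e ∂(sphereUniform n)) * ∫ x, g ‖x‖ ∂stdGaussian (Vec n) := by
  rw [stdGaussian_eq_withDensity]
  iterate 2 rw [integral_withDensity_eq_integral_toReal_smul (by fun_prop) (by simp)]
  have h := integral_normalize_mul_norm_addHaar (volume : Measure (Vec n)) ψ fun r =>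
    (ENNReal.ofReal ((2 * Real.pi) ^ (-(Module.finrank ℝ (Vec n) / 2 : ℝ)) *
      Real.exp (-r ^ 2 / 2))).toReal * g r
  simp_rw [smul_eq_mul, integral_sphereUniform, ← h, mul_left_comm]

lemma integral_sphereUniform_comp_linearIsometryEquiv [NeZero n] (A : Vec n ≃ₗᵢ[ℝ] Vec n)
    (ψ : Vec n → ℝ) : ∫ e, ψ (A e) ∂(sphereUniform n) = ∫ e, ψ e ∂(sphereUniform n) := by
  have direction (ψ : Vec n → ℝ) :
      ∫ e, ψ e ∂(sphereUniform n) = ∫ x, ψ (‖x‖⁻¹ • x) ∂stdGaussian (Vec n) := by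
    simpa using (integral_normalize_mul_norm_stdGaussian ψ fun _ => 1).symm
  have hA : MeasurePreserving A (stdGaussian (Vec n)) (stdGaussian (Vec n)) :=
    ⟨A.continuous.measurable, stdGaussian_map A⟩
  simp_rw [direction, ← hA.integral_comp A.toHomeomorph.measurableEmbedding fun x =>
    ψ (‖x‖⁻¹ • x), LinearIsometryEquiv.norm_map, map_smul]

lemma measurePreserving_apply_stdGaussian (i : Fin n) :
    MeasurePreserving (fun x : Vec n => x i) (stdGaussian (Vec n)) (gaussianReal 0 1) := by
  refine ⟨by fun_prop, ?_⟩
  rw [← map_pi_eq_stdGaussian, Measure.map_map (by fun_prop) (by fun_prop)]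
  exact (measurePreserving_eval (fun _ : Fin n => gaussianReal 0 1) i).map_eq

lemma integral_comp_apply_stdGaussian (i : Fin n) {f : ℝ → ℝ} (hf : Measurable f) :
    ∫ x, f (x i) ∂stdGaussian (Vec n) = ∫ y, f y ∂gaussianReal 0 1 := by
  rw [← (measurePreserving_apply_stdGaussian i).map_eq,
    integral_map (by fun_prop) hf.aestronglyMeasurable]

lemma integral_norm_sq_stdGaussian : ∫ x, ‖x‖ ^ 2 ∂stdGaussian (Vec n) = n := by
  have hcoord (i : Fin n) : ∫ x : Vec n, x i ^ 2 ∂stdGaussian (Vec n) = 1 := by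
    have h := variance_fun_id_gaussianReal (μ := 0) (v := 1)
    rw [variance_of_integral_eq_zero (by fun_prop) (by simp)] at h
    rw [integral_comp_apply_stdGaussian i (f := fun y => y ^ 2) (by fun_prop), h, NNReal.coe_one]
  have hint (i : Fin n) : Integrable (fun x : Vec n => x i ^ 2) (stdGaussian (Vec n)) :=
    (measurePreserving_apply_stdGaussian i).integrable_comp_of_integrable
      (g := fun y => y ^ 2) (IsGaussian.memLp_two_id.integrable_sq)
  simp_rw [EuclideanSpace.real_norm_sq_eq]
  rw [integral_finsetSum _ fun i _ => hint i]
  simp [hcoord]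

lemma integral_stdGaussian_of_homogeneous [NeZero n] {φ : Vec n → ℝ}
    (hφ : ∀ (r : ℝ) (x : Vec n), 0 < r → φ (r • x) = r ^ 2 * φ x) :
    ∫ x, φ x ∂stdGaussian (Vec n) = n * ∫ e, φ e ∂(sphereUniform n) := by
  rw [mul_comm, ← integral_norm_sq_stdGaussian,
    ← integral_normalize_mul_norm_stdGaussian φ fun r => r ^ 2]
  have h0 : φ 0 = 0 := by
    have h := hφ 2 0 two_pos
    rw [smul_zero] at h
    linarith
  congr with x
  rcases eq_or_ne x 0 with rfl | hx
  · simp [h0]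
  · rw [hφ _ _ (by positivity)]
    have := norm_ne_zero_iff.2 hx
    field_simp

end Sphere

/-- A function on `ℝⁿ` that is invariant under permutations and sign changes of coordinates; its
products with `e i * e j` have vanishing sphere averages for `i ≠ j`. -/
def IsSymmetricFn {n : ℕ} (φ : Vec n → ℝ) : Prop :=
  ∀ (x y : Vec n) (π : Equiv.Perm (Fin n)), (∀ i, |y i| = |x (π i)|) → φ y = φ x

section Moments

variable {n : ℕ} {φ : Vec n → ℝ}

lemma isSymmetricFn_const (c : ℝ) : IsSymmetricFn fun _ : Vec n => c :=
  fun _ _ _ _ => rfl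

lemma isSymmetricFn_lpNorm_sq (p : ℝ) : IsSymmetricFn fun x : Vec n => lpNorm p x ^ 2 := by
  intro x y π h
  simp only [lpNorm, h]
  rw [Equiv.sum_comp π fun i => |x i| ^ p]

lemma integral_coord_mul_coord_of_ne [NeZero n] (hφ : IsSymmetricFn φ) {i j : Fin n}
    (hij : i ≠ j) : ∫ e, e i * e j * φ e ∂(sphereUniform n) = 0 := by
  let A : Vec n ≃ₗᵢ[ℝ] Vec n := LinearIsometryEquiv.piLpCongrRight 2 fun k =>
    if k = i then LinearIsometryEquiv.neg ℝ else LinearIsometryEquiv.refl ℝ ℝ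
  have hAi (e : Vec n) : A e i = -e i := by simp [A]
  have hA (e : Vec n) {k : Fin n} (hk : k ≠ i) : A e k = e k := by simp [A, hk]
  have hφA (e : Vec n) : φ (A e) = φ e := hφ _ _ (Equiv.refl _) fun k => by
    rcases eq_or_ne k i with rfl | hk
    · simp [hAi]
    · simp [hA e hk]
  have h := integral_sphereUniform_comp_linearIsometryEquiv A fun e => e i * e j * φ e
  simp only [hφA, hAi, hA _ hij.symm, neg_mul, integral_neg] at h
  linarith

lemma integral_coord_mul_self [NeZero n] (hφ : IsSymmetricFn φ) (hφc : Continuous φ) (i : Fin n) :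
    ∫ e, e i * e i * φ e ∂(sphereUniform n) = (∫ e, φ e ∂(sphereUniform n)) / n := by
  have hswap (j : Fin n) : ∫ e, e j * e j * φ e ∂(sphereUniform n)
      = ∫ e, e i * e i * φ e ∂(sphereUniform n) := by
    let A : Vec n ≃ₗᵢ[ℝ] Vec n := LinearIsometryEquiv.piLpCongrLeft 2 ℝ ℝ (Equiv.swap i j)
    have hA (e : Vec n) (k : Fin n) : A e k = e (Equiv.swap i j k) := by
      simp [A, LinearIsometryEquiv.piLpCongrLeft_apply, Equiv.piCongrLeft']
    have hφA (e : Vec n) : φ (A e) = φ e := hφ _ _ (Equiv.swap i j) fun k => by rw [hA]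
    rw [← integral_sphereUniform_comp_linearIsometryEquiv A fun e => e i * e i * φ e]
    simp only [hφA, hA, Equiv.swap_apply_left]
  have hsum : ∑ j, ∫ e, e j * e j * φ e ∂(sphereUniform n) = ∫ e, φ e ∂(sphereUniform n) := by
    rw [← integral_finsetSum _ fun j _ => integrable_sphereUniform_of_continuous (by fun_prop)]
    refine integral_congr_ae ?_
    filter_upwards [ae_norm_eq_one_sphereUniform] with e he
    have := EuclideanSpace.real_norm_sq_eq e
    simp_rw [← Finset.sum_mul, ← sq, ← this, he, one_pow, one_mul]
  rw [eq_div_iff (NeZero.ne _), ← hsum, Finset.sum_congr rfl fun j _ => hswap j]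
  simp [mul_comm]

lemma integral_coord_mul_coord [NeZero n] (hφ : IsSymmetricFn φ) (hφc : Continuous φ)
    (i j : Fin n) : ∫ e, e i * e j * φ e ∂(sphereUniform n)
      = if i = j then (∫ e, φ e ∂(sphereUniform n)) / n else 0 := by
  split_ifs with h
  · subst h; exact integral_coord_mul_self hφ hφc i
  · exact integral_coord_mul_coord_of_ne hφ h

lemma abs_rpow_le_mul_exp {r s : ℝ} (hr : 0 < r) (hs : 0 < s) (x : ℝ) :
    |x| ^ r ≤ (r / s) ^ r * Real.exp (-r) * (Real.exp (s * x) + Real.exp (-s * x)) := by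
  have hexp : Real.exp (s * |x|) ≤ Real.exp (s * x) + Real.exp (-s * x) := by
    rcases abs_cases x with ⟨h, -⟩ | ⟨h, -⟩ <;> rw [h]
    · linarith [Real.exp_pos (-s * x)]
    · rw [mul_neg, ← neg_mul]
      linarith [Real.exp_pos (s * x)]
  have hlin : |x| ≤ r / s * Real.exp (s * |x| / r - 1) := by
    have := Real.add_one_le_exp (s * |x| / r - 1)
    calc |x| = r / s * (s * |x| / r - 1 + 1) := by field_simp; ring
      _ ≤ _ := by gcongr
  calc |x| ^ r ≤ (r / s * Real.exp (s * |x| / r - 1)) ^ r := by gcongr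
    _ = (r / s) ^ r * Real.exp (-r) * Real.exp (s * |x|) := by
        rw [Real.mul_rpow (by positivity) (by positivity), ← Real.exp_mul, mul_assoc,
          ← Real.exp_add]
        congr 2
        field_simp
        ring
    _ ≤ _ := by gcongr

lemma integrable_abs_rpow_gaussianReal {r : ℝ} (hr : 0 < r) :
    Integrable (fun x : ℝ => |x| ^ r) (gaussianReal 0 1) := by
  refine integrable_rpow_abs_of_mem_interior_integrableExpSet (X := id) ?_ hr.le
  simp

lemma integral_abs_rpow_gaussianReal_le {r : ℝ} (hr : 0 < r) :
    ∫ x, |x| ^ r ∂gaussianReal 0 1 ≤ 2 * (r / Real.exp 1) ^ (r / 2) := by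
  have hmgf (s : ℝ) : ∫ x, Real.exp (s * x) ∂gaussianReal 0 1 = Real.exp (s ^ 2 / 2) := by
    simpa [mgf] using congr_fun (mgf_id_gaussianReal (μ := 0) (v := 1)) s
  have hint (s : ℝ) : Integrable (fun x => Real.exp (s * x)) (gaussianReal 0 1) :=
    integrable_exp_mul_gaussianReal s
  have hbound := integral_mono (integrable_abs_rpow_gaussianReal hr)
    (((hint √r).add (hint (-√r))).const_mul ((r / √r) ^ r * Real.exp (-r)))
    (abs_rpow_le_mul_exp hr (Real.sqrt_pos.2 hr))
  simp only [Pi.add_apply] at hbound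
  rw [integral_const_mul, integral_add (hint _) (hint _), hmgf, hmgf, neg_sq, Real.sq_sqrt hr.le,
    Real.div_sqrt, ← two_mul] at hbound
  refine hbound.trans_eq ?_
  have hsqrt : √r ^ r = r ^ (r / 2) := by
    rw [Real.sqrt_eq_rpow, ← Real.rpow_mul hr.le, one_div_mul_eq_div]
  have hexp : Real.exp (-r) * Real.exp (r / 2) = (Real.exp 1 ^ (r / 2))⁻¹ := by
    rw [← Real.exp_add, ← Real.exp_mul, ← Real.exp_neg]
    ring_nf
  rw [Real.div_rpow hr.le (Real.exp_pos 1).le, hsqrt, div_eq_mul_inv (r ^ (r / 2)), ← hexp]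
  ac_rfl

lemma integral_lpNorm_sq_stdGaussian_le {r : ℝ} (hr : 2 ≤ r) :
    ∫ x, lpNorm r x ^ 2 ∂stdGaussian (Vec n)
      ≤ (n * ∫ y, |y| ^ r ∂gaussianReal 0 1) ^ (2 / r) := by
  have hr0 : 0 < r := by linarith
  have hcoord (i : Fin n) : Integrable (fun x : Vec n => |x i| ^ r) (stdGaussian (Vec n)) :=
    (measurePreserving_apply_stdGaussian i).integrable_comp_of_integrable
      (g := fun y => |y| ^ r) (integrable_abs_rpow_gaussianReal hr0)
  have hmoment : ∫ x : Vec n, ∑ i, |x i| ^ r ∂stdGaussian (Vec n)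
      = n * ∫ y, |y| ^ r ∂gaussianReal 0 1 := by
    rw [integral_finsetSum _ fun i _ => hcoord i, Finset.sum_congr rfl fun i _ =>
      integral_comp_apply_stdGaussian i (f := fun y => |y| ^ r) (by fun_prop)]
    simp
  have hint : Integrable (fun x : Vec n => lpNorm r x ^ 2) (stdGaussian (Vec n)) := by
    refine (IsGaussian.memLp_two_id (μ := stdGaussian (Vec n))).norm.integrable_sq.mono'
      ((continuous_lpNorm hr0).pow 2).aestronglyMeasurable (ae_of_all _ fun x => ?_)
    rw [Real.norm_of_nonneg (sq_nonneg _), id, ← lpNorm_two]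
    exact pow_le_pow_left₀ (lpNorm_nonneg _ _) (lpNorm_anti two_pos hr x) 2
  simp_rw [lpNorm_sq] at hint ⊢
  rw [← hmoment]
  have hconc : ConcaveOn ℝ (Set.Ici 0) fun x : ℝ => x ^ (2 / r) :=
    Real.concaveOn_rpow (by positivity) ((div_le_one hr0).2 hr)
  have hcont : Continuous fun x : ℝ => x ^ (2 / r) :=
    Real.continuous_rpow_const (by positivity)
  refine hconc.le_map_integral hcont.continuousOn isClosed_Ici
    (ae_of_all _ fun x => Set.mem_Ici.2 (by positivity))
    (integrable_finsetSum _ fun i _ => hcoord i) hint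

lemma integral_lpNorm_sq_sphereUniform_le [NeZero n] {r : ℝ} (hr : 2 ≤ r) :
    ∫ e, lpNorm r e ^ 2 ∂(sphereUniform n)
      ≤ 4 / Real.exp 1 * ((r - 1) * (n : ℝ) ^ (2 / r - 1)) := by
  have hr0 : 0 < r := by linarith
  have hn : 0 < (n : ℝ) := Nat.cast_pos.2 (NeZero.pos n)
  have hconst : (2 * (r / Real.exp 1) ^ (r / 2)) ^ (2 / r) ≤ 4 / Real.exp 1 * (r - 1) := by
    calc (2 * (r / Real.exp 1) ^ (r / 2)) ^ (2 / r) = 2 ^ (2 / r) * (r / Real.exp 1) := by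
          rw [Real.mul_rpow (by positivity) (by positivity), ← Real.rpow_mul (by positivity),
            div_mul_div_comm, mul_comm r, div_self (by positivity), Real.rpow_one]
      _ ≤ 2 ^ (1 : ℝ) * (r / Real.exp 1) := by
          gcongr
          · exact one_le_two
          · exact (div_le_one hr0).2 hr
      _ = 2 / Real.exp 1 * r := by rw [Real.rpow_one]; ring
      _ ≤ 2 / Real.exp 1 * (2 * (r - 1)) := by gcongr; linarith
      _ = _ := by ring
  have hgauss : n * ∫ e, lpNorm r e ^ 2 ∂(sphereUniform n)
      ≤ (n : ℝ) ^ (2 / r) * (4 / Real.exp 1 * (r - 1)) := by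
    rw [← integral_stdGaussian_of_homogeneous fun c x _ => by
      rw [lpNorm_smul hr0.ne', mul_pow, sq_abs]]
    calc _ ≤ (n * ∫ y, |y| ^ r ∂gaussianReal 0 1) ^ (2 / r) :=
          integral_lpNorm_sq_stdGaussian_le hr
      _ ≤ (n * (2 * (r / Real.exp 1) ^ (r / 2))) ^ (2 / r) := by
          gcongr
          exact integral_abs_rpow_gaussianReal_le hr0
      _ ≤ _ := by
          rw [Real.mul_rpow hn.le (by positivity)]
          gcongr
  rw [Real.rpow_sub_one hn.ne']
  refine (le_div_iff₀' hn).2 hgauss |>.trans_eq ?_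
  ring

end Moments

section Exponents

variable {n : ℕ} {p : ℝ}

lemma two_lt_log (hn : 8 ≤ n) : 2 < Real.log n := by
  calc (2 : ℝ) < 3 * Real.log 2 := by linarith [Real.log_two_gt_d9]
    _ = Real.log (2 ^ 3) := by rw [Real.log_pow]; norm_num
    _ ≤ Real.log n := Real.log_le_log (by norm_num) (by norm_num; exact_mod_cast hn)

/-- The exponent `min {q, 2 ln n}`, where `1 / p + 1 / q = 1`; it is `2 ln n` for `p = 1`. The
norm with this exponent dominates the dual norm `‖·‖_q`, and its mean square on the sphere is of
the order of `ρ_n`. -/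
def dualExp (p : ℝ) (n : ℕ) : ℝ :=
  if p = 1 then 2 * Real.log n else min (p / (p - 1)) (2 * Real.log n)

lemma two_le_conjExponent (h1 : 1 < p) (h2 : p ≤ 2) : 2 ≤ p / (p - 1) := by
  rw [le_div_iff₀ (sub_pos.2 h1)]
  linarith

lemma two_le_dualExp (hn : 8 ≤ n) (h1 : 1 ≤ p) (h2 : p ≤ 2) : 2 ≤ dualExp p n := by
  have hl : 2 ≤ 2 * Real.log n := by linarith [two_lt_log hn]
  unfold dualExp
  split_ifs with h
  · exact hl
  · exact le_min (two_le_conjExponent (lt_of_le_of_ne' h1 h) h2) hl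

lemma le_conjExponent_dualExp (hn : 8 ≤ n) (h1 : 1 ≤ p) (h2 : p ≤ 2) :
    p ≤ dualExp p n / (dualExp p n - 1) := by
  have hr := two_le_dualExp hn h1 h2
  rw [le_div_iff₀ (by linarith)]
  rcases h1.eq_or_lt with rfl | hp
  · linarith
  · have : dualExp p n ≤ p / (p - 1) := (if_neg hp.ne').trans_le (min_le_left _ _)
    rw [le_div_iff₀ (sub_pos.2 hp)] at this
    linarith

lemma inner_le_lpNorm_dualExp_mul_lpNorm (hn : 8 ≤ n) (h1 : 1 ≤ p) (h2 : p ≤ 2) (x y : Vec n) :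
    inner ℝ x y ≤ lpNorm (dualExp p n) x * lpNorm p y := by
  have hr : 1 < dualExp p n := one_lt_two.trans_le (two_le_dualExp hn h1 h2)
  calc inner ℝ x y
      ≤ lpNorm (dualExp p n) x * lpNorm (dualExp p n / (dualExp p n - 1)) y :=
        inner_le_lpNorm_mul_lpNorm (.conjExponent hr) x y
    _ ≤ lpNorm (dualExp p n) x * lpNorm p y :=
        mul_le_mul_of_nonneg_left
          (lpNorm_anti (zero_lt_one.trans_le h1) (le_conjExponent_dualExp hn h1 h2) y)
          (lpNorm_nonneg _ _)

lemma inv_le_rpow_two_div_sub_one (hn : n ≠ 0) (h1 : 1 ≤ p) :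
    (n : ℝ)⁻¹ ≤ (n : ℝ) ^ (2 * (1 - 1 / p) - 1) := by
  have : 1 / p ≤ 1 := (div_le_one (by linarith)).2 h1
  rw [← Real.rpow_neg_one]
  exact Real.rpow_le_rpow_of_exponent_le (mod_cast Nat.one_le_iff_ne_zero.2 hn) (by linarith)

lemma mul_inv_le_rho {c : ℝ} (hn : 8 ≤ n) (h1 : 1 ≤ p) (hc0 : 0 ≤ c)
    (hcp : p ≠ 1 → c ≤ p / (p - 1) - 1) (hcn : c ≤ 16 * Real.log n - 8) :
    c * (n : ℝ)⁻¹ ≤ rho p n := by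
  have hc : c ≤ if p = 1 then 16 * Real.log n - 8
      else min (p / (p - 1) - 1) (16 * Real.log n - 8) := by
    split_ifs with h
    · exact hcn
    · exact le_min (hcp h) hcn
  exact mul_le_mul hc (inv_le_rpow_two_div_sub_one (by omega) h1) (by positivity) (hc0.trans hc)

lemma one_le_card_mul_rho (hn : 8 ≤ n) (h1 : 1 ≤ p) (h2 : p ≤ 2) : 1 ≤ n * rho p n := by
  have hn0 : (0 : ℝ) < n := by positivity
  have h := mul_inv_le_rho hn h1 zero_le_one
    (fun h => by linarith [two_le_conjExponent (lt_of_le_of_ne' h1 h) h2])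
    (by linarith [two_lt_log hn])
  rwa [one_mul, inv_le_iff_one_le_mul₀' hn0] at h

lemma rho_pos (hn : 8 ≤ n) (h1 : 1 ≤ p) (h2 : p ≤ 2) : 0 < rho p n :=
  pos_of_mul_pos_right (zero_lt_one.trans_le (one_le_card_mul_rho hn h1 h2)) n.cast_nonneg

lemma card_mul_rho_one_le (n : ℕ) : n * rho 1 n ≤ 16 * Real.log n := by
  rcases eq_or_ne n 0 with rfl | hn
  · simp
  · have : n * rho 1 n = 16 * Real.log n - 8 := by
      norm_num [rho, Real.rpow_neg_one]
      field_simp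
    linarith

lemma dualExp_sub_one_mul_rpow_le (hn : 8 ≤ n) (h1 : 1 ≤ p) (h2 : p ≤ 2) :
    (dualExp p n - 1) * (n : ℝ) ^ (2 / dualExp p n - 1) ≤ Real.exp 1 * rho p n := by
  have hl := two_lt_log hn
  have hn0 : (0 : ℝ) < n := by positivity
  by_cases hq : p ≠ 1 ∧ p / (p - 1) ≤ 2 * Real.log n
  · have : 0 < p - 1 := sub_pos.2 (lt_of_le_of_ne' h1 hq.1)
    have hrho : rho p n = (dualExp p n - 1) * (n : ℝ) ^ (2 / dualExp p n - 1) := by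
      rw [rho, dualExp, if_neg hq.1, if_neg hq.1, min_eq_left hq.2, min_eq_left (by linarith)]
      congr 2
      field_simp
    rw [← hrho]
    exact le_mul_of_one_le_left (rho_pos hn h1 h2).le (Real.one_le_exp zero_le_one)
  · have hr : dualExp p n = 2 * Real.log n := by
      unfold dualExp
      split_ifs with h
      · rfl
      · exact min_eq_right (not_le.1 fun h' => hq ⟨h, h'⟩).le
    have hpow : (n : ℝ) ^ (2 / dualExp p n - 1) = Real.exp 1 * (n : ℝ)⁻¹ := by
      rw [Real.rpow_sub_one hn0.ne', hr, Real.rpow_def_of_pos hn0, div_eq_mul_inv]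
      congr 2
      field_simp
    rw [hpow, hr, mul_left_comm]
    gcongr
    refine mul_inv_le_rho hn h1 (by linarith) (fun h => ?_) (by linarith)
    linarith [not_le.1 fun h' => hq ⟨h, h'⟩]

lemma integral_lpNorm_dualExp_sq_le (hn : 8 ≤ n) (h1 : 1 ≤ p) (h2 : p ≤ 2) :
    ∫ e, lpNorm (dualExp p n) e ^ 2 ∂(sphereUniform n) ≤ 4 * rho p n := by
  have : NeZero n := ⟨by omega⟩
  calc _ ≤ 4 / Real.exp 1 * ((dualExp p n - 1) * (n : ℝ) ^ (2 / dualExp p n - 1)) :=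
        integral_lpNorm_sq_sphereUniform_le (two_le_dualExp hn h1 h2)
    _ ≤ 4 / Real.exp 1 * (Real.exp 1 * rho p n) := by
        gcongr ?_ * ?_
        exact dualExp_sub_one_mul_rpow_le hn h1 h2
    _ = 4 * rho p n := by field_simp

end Exponents

section ProxFunctions

variable {n : ℕ} {κ δ : ℝ}

lemma inner_gradient (f : Vec n → ℝ) (x v : Vec n) :
    inner ℝ (gradient f x) v = fderiv ℝ f x v := by
  rw [gradient, InnerProductSpace.toDual_symm_apply]

lemma differentiable_lpNorm_sq (h1 : 1 < κ) (h2 : κ ≤ 2) :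
    Differentiable ℝ fun x : Vec n => lpNorm κ x ^ 2 := by
  simp_rw [lpNorm_sq]
  intro x
  refine .rpow_const (.fun_sum fun i _ => ?_)
    (Or.inr ((one_le_div (by linarith)).2 h2))
  exact (hasDerivAt_abs_rpow (x i) h1).differentiableAt.comp x (f := fun x : Vec n => x i)
    (by fun_prop)

/-- The square of the `ℓ_κ` norm of the vector with entries `√(uᵢ² + δ²)`; for `δ > 0` it is a
smooth approximation of `lpNorm κ u ^ 2`. -/
def smoothedLpNormSq (κ δ : ℝ) (u : Vec n) : ℝ := (∑ i, (u i ^ 2 + δ ^ 2) ^ (κ / 2)) ^ (2 / κ)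

lemma lpNorm_sq_le_sum_rpow_mul_sum (hκ : 0 < κ) (h2 : κ ≤ 2) {a : Fin n → ℝ} (ha : ∀ i, 0 < a i)
    (v : Vec n) : lpNorm κ v ^ 2
      ≤ (∑ i, a i ^ (κ / 2)) ^ (2 / κ - 1) * ∑ i, a i ^ (κ / 2 - 1) * v i ^ 2 := by
  have h := Real.inner_le_weight_mul_Lp_of_nonneg Finset.univ (p := 2 / κ)
    ((one_le_div hκ).2 h2) (fun i => a i ^ (κ / 2)) (fun i => (v i ^ 2 / a i) ^ (κ / 2))
    (fun i => (Real.rpow_pos_of_pos (ha i) _).le)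
    (fun i => Real.rpow_nonneg (div_nonneg (sq_nonneg _) (ha i).le) _)
  have hκκ : κ / 2 * (2 / κ) = 1 := by field_simp
  have hleft (i : Fin n) : a i ^ (κ / 2) * (v i ^ 2 / a i) ^ (κ / 2) = |v i| ^ κ := by
    rw [← Real.mul_rpow (ha i).le (div_nonneg (sq_nonneg _) (ha i).le),
      mul_div_cancel₀ _ (ha i).ne', ← sq_abs, ← Real.rpow_natCast_mul (abs_nonneg _)]
    congr 1
    push_cast
    ring
  have hright (i : Fin n) : a i ^ (κ / 2) * ((v i ^ 2 / a i) ^ (κ / 2)) ^ (2 / κ)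
      = a i ^ (κ / 2 - 1) * v i ^ 2 := by
    rw [← Real.rpow_mul (div_nonneg (sq_nonneg _) (ha i).le), hκκ, Real.rpow_one,
      Real.rpow_sub_one (ha i).ne']
    ring
  simp only [hleft, hright, inv_div] at h
  have hT : 0 ≤ ∑ i, a i ^ (κ / 2 - 1) * v i ^ 2 :=
    Finset.sum_nonneg fun i _ => mul_nonneg (Real.rpow_pos_of_pos (ha i) _).le (sq_nonneg _)
  have hS : 0 ≤ ∑ i, a i ^ (κ / 2) :=
    Finset.sum_nonneg fun i _ => (Real.rpow_pos_of_pos (ha i) _).le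
  calc lpNorm κ v ^ 2 = (∑ i, |v i| ^ κ) ^ (2 / κ) := lpNorm_sq κ v
    _ ≤ ((∑ i, a i ^ (κ / 2)) ^ (1 - κ / 2) *
          (∑ i, a i ^ (κ / 2 - 1) * v i ^ 2) ^ (κ / 2)) ^ (2 / κ) := by gcongr
    _ = _ := by
      rw [Real.mul_rpow (by positivity) (by positivity), ← Real.rpow_mul hT, ← Real.rpow_mul hS]
      have : (1 - κ / 2) * (2 / κ) = 2 / κ - 1 := by field_simp
      rw [this, hκκ, Real.rpow_one]

lemma convexOn_rpow_sub_sq {S S' S'' : ℝ → ℝ} {θ c : ℝ} (hθ : 1 ≤ θ) (hS : ∀ s, 0 < S s)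
    (hS' : ∀ s, HasDerivAt S (S' s) s) (hS'' : ∀ s, HasDerivAt S' (S'' s) s)
    (hc : ∀ s, 2 * c ≤ θ * S s ^ (θ - 1) * S'' s) :
    ConvexOn ℝ Set.univ fun s => S s ^ θ - c * s ^ 2 := by
  have hf' (s : ℝ) : HasDerivAt (fun s => S s ^ θ - c * s ^ 2)
      (θ * (S s ^ (θ - 1) * S' s) - c * (2 * s)) s := by
    convert! ((hS' s).rpow_const (Or.inl (hS s).ne')).sub
      ((hasDerivAt_pow 2 s).const_mul c) using 1
    push_cast
    ring
  have hf'' (s : ℝ) : HasDerivAt (fun s => θ * (S s ^ (θ - 1) * S' s) - c * (2 * s))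
      (θ * ((θ - 1) * S s ^ (θ - 1 - 1) * S' s ^ 2 + S s ^ (θ - 1) * S'' s) - c * 2) s := by
    convert! ((((hS' s).rpow_const (p := θ - 1) (Or.inl (hS s).ne')).mul (hS'' s)).const_mul θ).sub
      (((hasDerivAt_id s).const_mul 2).const_mul c) using 1
    ring
  refine convexOn_of_hasDerivWithinAt2_nonneg convex_univ
    (fun s _ => (hf' s).continuousAt.continuousWithinAt) (fun s _ => (hf' s).hasDerivWithinAt)
    (fun s _ => (hf'' s).hasDerivWithinAt) fun s _ => ?_
  have : 0 ≤ θ * ((θ - 1) * S s ^ (θ - 1 - 1) * S' s ^ 2) := by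
    have := (hS s).le
    have := sub_nonneg.2 hθ
    positivity
  linarith [hc s]

lemma hasDerivAt_sq_add_rpow (hδ : 0 < δ) (a b r s : ℝ) :
    HasDerivAt (fun s => ((a + s * b) ^ 2 + δ ^ 2) ^ r)
      (2 * r * (((a + s * b) ^ 2 + δ ^ 2) ^ (r - 1) * ((a + s * b) * b))) s := by
  have h : HasDerivAt (fun s => a + s * b) b s := by
    simpa using ((hasDerivAt_id s).mul_const b).const_add a
  convert! ((h.fun_pow 2).add_const (δ ^ 2)).rpow_const (p := r) (Or.inl (by positivity)) using 1
  push_cast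
  ring

lemma hasDerivAt_deriv_sq_add_rpow (hδ : 0 < δ) (a b s : ℝ) :
    HasDerivAt (fun s => κ * (((a + s * b) ^ 2 + δ ^ 2) ^ (κ / 2 - 1) * ((a + s * b) * b)))
      (κ * (((a + s * b) ^ 2 + δ ^ 2) ^ (κ / 2 - 1) * b ^ 2 - (2 - κ) *
        (((a + s * b) ^ 2 + δ ^ 2) ^ (κ / 2 - 1 - 1) * (a + s * b) ^ 2) * b ^ 2)) s := by
  have h : HasDerivAt (fun s => (a + s * b) * b) (b * b) s := by
    simpa using (((hasDerivAt_id s).mul_const b).const_add a).mul_const b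
  convert! ((hasDerivAt_sq_add_rpow hδ a b (κ / 2 - 1) s).mul h).const_mul κ using 1
  ring

lemma le_second_deriv_sq_add_rpow (hκ : 0 ≤ κ) (h2 : κ ≤ 2) (hδ : 0 < δ) (a b : ℝ) :
    κ * (κ - 1) * ((a ^ 2 + δ ^ 2) ^ (κ / 2 - 1) * b ^ 2)
      ≤ κ * ((a ^ 2 + δ ^ 2) ^ (κ / 2 - 1) * b ^ 2
        - (2 - κ) * ((a ^ 2 + δ ^ 2) ^ (κ / 2 - 1 - 1) * a ^ 2) * b ^ 2) := by
  have hA : 0 < a ^ 2 + δ ^ 2 := by positivity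
  have h : (a ^ 2 + δ ^ 2) ^ (κ / 2 - 1 - 1) * a ^ 2 ≤ (a ^ 2 + δ ^ 2) ^ (κ / 2 - 1) := by
    rw [Real.rpow_sub_one hA.ne' (κ / 2 - 1), div_mul_eq_mul_div, div_le_iff₀ hA]
    gcongr
    linarith [sq_nonneg δ]
  calc _ = κ * ((a ^ 2 + δ ^ 2) ^ (κ / 2 - 1) * b ^ 2
        - (2 - κ) * (a ^ 2 + δ ^ 2) ^ (κ / 2 - 1) * b ^ 2) := by ring
    _ ≤ _ := by
      have := sub_nonneg.2 h2
      gcongr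

lemma convexOn_smoothedLpNormSq_sub [NeZero n] (h1 : 1 ≤ κ) (h2 : κ ≤ 2) (hδ : 0 < δ)
    (x v : Vec n) : ConvexOn ℝ Set.univ fun s : ℝ =>
      smoothedLpNormSq κ δ (x + s • v) - (κ - 1) * lpNorm κ v ^ 2 * s ^ 2 := by
  have hκ : 0 < κ := by linarith
  refine convexOn_rpow_sub_sq
    (S := fun s => ∑ i, ((x i + s * v i) ^ 2 + δ ^ 2) ^ (κ / 2))
    ((one_le_div hκ).2 h2) (fun s => Finset.sum_pos (fun i _ => by positivity)
      Finset.univ_nonempty)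
    (fun s => .fun_sum fun i _ => ?_)
    (fun s => .fun_sum fun i _ => hasDerivAt_deriv_sq_add_rpow (κ := κ) hδ (x i) (v i) s)
    fun s => ?_
  · simpa [mul_div_cancel₀] using hasDerivAt_sq_add_rpow hδ (x i) (v i) (κ / 2) s
  · have hv := lpNorm_sq_le_sum_rpow_mul_sum hκ h2
      (a := fun i => (x i + s * v i) ^ 2 + δ ^ 2) (fun i => by positivity) v
    set S := ∑ i, ((x i + s * v i) ^ 2 + δ ^ 2) ^ (κ / 2)
    set T := ∑ i, ((x i + s * v i) ^ 2 + δ ^ 2) ^ (κ / 2 - 1) * v i ^ 2 with hT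
    have hS0 : 0 ≤ S := by positivity
    calc 2 * ((κ - 1) * lpNorm κ v ^ 2) ≤ 2 * ((κ - 1) * (S ^ (2 / κ - 1) * T)) := by
          have := sub_nonneg.2 h1
          gcongr
      _ = 2 / κ * S ^ (2 / κ - 1) * (κ * (κ - 1) * T) := by field_simp
      _ ≤ _ := by
          rw [hT, Finset.mul_sum]
          gcongr (_ * ∑ i, ?_) with i
          exact le_second_deriv_sq_add_rpow hκ.le h2 hδ _ _

lemma tendsto_smoothedLpNormSq (hκ : 0 < κ) (u : Vec n) :
    Filter.Tendsto (fun δ => smoothedLpNormSq κ δ u) (nhdsWithin 0 (Set.Ioi 0))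
      (nhds (lpNorm κ u ^ 2)) := by
  have hcont : Continuous fun δ => smoothedLpNormSq κ δ u :=
    .rpow_const (continuous_finsetSum _ fun i _ => .rpow_const (by fun_prop)
      fun δ => Or.inr (by positivity)) fun δ => Or.inr (by positivity)
  have hzero : smoothedLpNormSq κ 0 u = lpNorm κ u ^ 2 := by
    rw [lpNorm_sq, smoothedLpNormSq]
    congr with i
    rw [zero_pow two_ne_zero, add_zero, ← sq_abs, ← Real.rpow_natCast_mul (abs_nonneg _)]
    congr 1
    push_cast
    ring
  exact hzero ▸ (hcont.tendsto 0).mono_left nhdsWithin_le_nhds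

lemma convexOn_lpNorm_sq_sub [NeZero n] (h1 : 1 ≤ κ) (h2 : κ ≤ 2) (x v : Vec n) :
    ConvexOn ℝ Set.univ fun s : ℝ =>
      lpNorm κ (x + s • v) ^ 2 - (κ - 1) * lpNorm κ v ^ 2 * s ^ 2 := by
  refine ⟨convex_univ, fun s _ t _ a b ha hb hab => ?_⟩
  have lim (s : ℝ) := (tendsto_smoothedLpNormSq (by linarith : 0 < κ) (x + s • v)).sub_const
    ((κ - 1) * lpNorm κ v ^ 2 * s ^ 2)
  refine le_of_tendsto_of_tendsto (lim _) (((lim s).const_smul a).add ((lim t).const_smul b)) ?_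
  filter_upwards [self_mem_nhdsWithin] with δ hδ
  exact (convexOn_smoothedLpNormSq_sub h1 h2 hδ x v).2 trivial trivial ha hb hab

lemma lpNorm_sq_strongly_convex [NeZero n] (h1 : 1 < κ) (h2 : κ ≤ 2) (x y : Vec n) :
    (κ - 1) * lpNorm κ (y - x) ^ 2 ≤ lpNorm κ y ^ 2 - lpNorm κ x ^ 2
      - fderiv ℝ (fun x : Vec n => lpNorm κ x ^ 2) x (y - x) := by
  have hline : HasDerivAt (fun s : ℝ => x + s • (y - x)) (y - x) 0 := by
    simpa using ((hasDerivAt_id (0 : ℝ)).smul_const (y - x)).const_add x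
  have hnorm : HasFDerivAt (fun x : Vec n => lpNorm κ x ^ 2)
      (fderiv ℝ (fun x : Vec n => lpNorm κ x ^ 2) x) (x + (0 : ℝ) • (y - x)) := by
    rw [zero_smul, add_zero]
    exact (differentiable_lpNorm_sq h1 h2 x).hasFDerivAt
  have h := (convexOn_lpNorm_sq_sub h1.le h2 x (y - x)).le_slope_of_hasDerivAt trivial trivial
    zero_lt_one ((hnorm.comp_hasDerivAt 0 hline).sub
      ((hasDerivAt_pow 2 (0 : ℝ)).const_mul ((κ - 1) * lpNorm κ (y - x) ^ 2)))
  rw [slope_def_field, one_smul, add_sub_cancel, zero_smul, add_zero] at h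
  norm_num at h
  rw [map_sub]
  linarith

lemma isProxFunction_proxOne (hn : 8 ≤ n) : IsProxFunction 1 (proxOne n) := by
  have : NeZero n := ⟨by omega⟩
  have hl := two_lt_log hn
  have hn0 : (0 : ℝ) < n := by positivity
  set κ := kappa n
  have hκ1 : κ - 1 = 1 / Real.log n := add_sub_cancel_left _ _
  have h1 : 1 < κ := sub_pos.1 (hκ1 ▸ by positivity)
  have h2 : κ ≤ 2 := by
    have : 1 / Real.log n ≤ 1 := (div_le_one (by linarith)).2 (by linarith)
    linarith
  set A := Real.exp 1 * (n : ℝ) ^ ((κ - 1) * (2 - κ) / κ) * Real.log n with hA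
  have hproxOne : proxOne n = fun x : Vec n => A / 2 * lpNorm κ x ^ 2 := rfl
  have hAκ : A * (κ - 1) = ((n : ℝ) ^ (1 - 1 / κ)) ^ 2 := by
    have hexp : Real.exp 1 = (n : ℝ) ^ (κ - 1) := by
      rw [hκ1, Real.rpow_def_of_pos hn0, mul_one_div_cancel (by positivity)]
    rw [hA, hκ1, mul_assoc, mul_one_div_cancel (by positivity), mul_one, ← hκ1, hexp,
      ← Real.rpow_add hn0, ← Real.rpow_mul_natCast hn0.le]
    congr 1
    field_simp
    push_cast
    ring
  have hdiff : Differentiable ℝ fun x : Vec n => lpNorm κ x ^ 2 := differentiable_lpNorm_sq h1 h2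
  refine ⟨hproxOne ▸ hdiff.const_mul _, fun x y => ?_⟩
  calc 1 / 2 * lpNorm 1 (y - x) ^ 2 ≤ 1 / 2 * ((n : ℝ) ^ (1 - 1 / κ) * lpNorm κ (y - x)) ^ 2 := by
        have := lpNorm_nonneg 1 (y - x)
        gcongr
        exact lpNorm_one_le h1 _
    _ = A / 2 * ((κ - 1) * lpNorm κ (y - x) ^ 2) := by rw [mul_pow, ← hAκ]; ring
    _ ≤ A / 2 * (lpNorm κ y ^ 2 - lpNorm κ x ^ 2
          - fderiv ℝ (fun x : Vec n => lpNorm κ x ^ 2) x (y - x)) := by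
        gcongr
        exact lpNorm_sq_strongly_convex h1 h2 x y
    _ = _ := by
        rw [inner_gradient, hproxOne, fderiv_const_mul (hdiff x)]
        simp only [smul_apply, smul_eq_mul]
        ring

lemma isProxFunction_proxTwo (n : ℕ) : IsProxFunction 2 (proxTwo n) := by
  have hd (x : Vec n) : HasFDerivAt (proxTwo n) (innerSL ℝ x) x := by
    convert! (hasStrictFDerivAt_norm_sq x).hasFDerivAt.const_mul (1 / 2) using 1
    ext v
    simp
  refine ⟨fun x => (hd x).differentiableAt, fun x y => ?_⟩
  rw [inner_gradient, (hd x).fderiv, lpNorm_two, innerSL_apply_apply, proxTwo, proxTwo,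
    norm_sub_sq_real, inner_sub_right, real_inner_self_eq_norm_sq, real_inner_comm x y]
  linarith

end ProxFunctions

section MirrorStep

variable {n : ℕ} {p : ℝ} {d : Vec n → ℝ}

lemma half_lpNorm_sq_le_bregman (hd : IsProxFunction p d) (z x : Vec n) :
    1 / 2 * lpNorm p (x - z) ^ 2 ≤ bregman d z x := hd.strongly_convex z x

lemma bregman_nonneg (hd : IsProxFunction p d) (z x : Vec n) : 0 ≤ bregman d z x :=
  le_trans (by positivity) (half_lpNorm_sq_le_bregman hd z x)

lemma half_norm_sq_le_bregman (hd : IsProxFunction p d) (h0 : 0 < p) (h2 : p ≤ 2) (z x : Vec n) :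
    1 / 2 * ‖x - z‖ ^ 2 ≤ bregman d z x := by
  refine le_trans ?_ (half_lpNorm_sq_le_bregman hd z x)
  have := norm_le_lpNorm h0 h2 (x - z)
  gcongr

lemma norm_sub_le_norm_gradient_sub (hd : IsProxFunction p d) (h0 : 0 < p) (h2 : p ≤ 2)
    (x y : Vec n) : ‖x - y‖ ≤ ‖gradient d x - gradient d y‖ := by
  have hyx := half_norm_sq_le_bregman hd h0 h2 x y
  have hxy := half_norm_sq_le_bregman hd h0 h2 y x
  have hsum : bregman d x y + bregman d y x
      = inner ℝ (gradient d x - gradient d y) (x - y) := by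
    simp only [bregman, inner_sub_left, inner_sub_right]
    ring
  have hcs := real_inner_le_norm (gradient d x - gradient d y) (x - y)
  rw [norm_sub_rev] at hyx
  rcases (norm_nonneg (x - y)).eq_or_lt with h | h
  · rw [← h]
    positivity
  · refine le_of_mul_le_mul_right (a := ‖x - y‖) ?_ h
    linarith [sq ‖x - y‖]

lemma exists_forall_sub_inner_le (hd : IsProxFunction p d) (h0 : 0 < p) (h2 : p ≤ 2) (w : Vec n) :
    ∃ x, ∀ y, d x - inner ℝ w x ≤ d y - inner ℝ w y := by
  have hcont : Continuous fun x => d x - inner ℝ w x := by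
    have := hd.differentiable.continuous
    fun_prop
  refine hcont.exists_forall_le ?_
  have hlow (y) : d 0 + ‖y‖ * (1 / 2 * ‖y‖ - ‖gradient d 0 - w‖) ≤ d y - inner ℝ w y := by
    have hquad := half_norm_sq_le_bregman hd h0 h2 0 y
    have hcs := neg_le_of_abs_le (abs_real_inner_le_norm (gradient d 0 - w) y)
    simp only [bregman, sub_zero] at hquad
    rw [inner_sub_left] at hcs
    linarith
  refine Filter.tendsto_atTop_mono hlow (Filter.tendsto_atTop_add_const_left _ _ ?_)
  have hnorm : Filter.Tendsto (fun y : Vec n => ‖y‖) (Filter.cocompact _) Filter.atTop :=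
    tendsto_norm_cocompact_atTop
  exact hnorm.atTop_mul_atTop₀
    (Filter.tendsto_atTop_add_const_right _ _ (hnorm.const_mul_atTop one_half_pos))

lemma gradient_eq_of_forall_sub_inner_le (hd : Differentiable ℝ d) {w x : Vec n}
    (h : ∀ y, d x - inner ℝ w x ≤ d y - inner ℝ w y) : gradient d x = w := by
  have hmin : IsLocalMin (fun u => d u - inner ℝ w u) x := Filter.Eventually.of_forall h
  have hder : HasFDerivAt (fun u => d u - inner ℝ w u) (fderiv ℝ d x - innerSL ℝ w) x :=
    (hd x).hasFDerivAt.sub (innerSL ℝ w).hasFDerivAt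
  refine ext_inner_right ℝ fun v => ?_
  rw [inner_gradient, sub_eq_zero.1 (hmin.hasFDerivAt_eq_zero hder), innerSL_apply_apply]

/-- The mirror map, inverse to the gradient of a prox-function `d`. It is the gradient of the
convex conjugate of `d`, encoded through the minimization that defines the conjugate, so that
the step of the method has literally this form. -/
def mirrorInv (d : Vec n → ℝ) (w : Vec n) : Vec n := argminPt fun u => d u - inner ℝ w u

lemma gradient_mirrorInv (hd : IsProxFunction p d) (h0 : 0 < p) (h2 : p ≤ 2) (w : Vec n) :
    gradient d (mirrorInv d w) = w :=
  gradient_eq_of_forall_sub_inner_le hd.differentiable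
    (Classical.epsilon_spec (exists_forall_sub_inner_le hd h0 h2 w))

lemma continuous_mirrorInv (hd : IsProxFunction p d) (h0 : 0 < p) (h2 : p ≤ 2) :
    Continuous (mirrorInv d) := by
  refine (LipschitzWith.of_dist_le_mul (K := 1) fun w w' => ?_).continuous
  have := norm_sub_le_norm_gradient_sub hd h0 h2 (mirrorInv d w) (mirrorInv d w')
  rw [gradient_mirrorInv hd h0 h2, gradient_mirrorInv hd h0 h2] at this
  simpa [dist_eq_norm] using this

lemma argminPt_eq_mirrorInv (z a : Vec n) :
    (argminPt fun u => inner ℝ a (u - z) + bregman d z u) = mirrorInv d (gradient d z - a) := by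
  have hshift (u) : inner ℝ a (u - z) + bregman d z u = (d u - inner ℝ (gradient d z - a) u)
      + (inner ℝ (gradient d z - a) z - d z) := by
    simp only [bregman, inner_sub_left, inner_sub_right]
    ring
  simp only [mirrorInv, argminPt, hshift, add_le_add_iff_right]

lemma measurable_gradient (d : Vec n → ℝ) : Measurable (gradient d) :=
  (InnerProductSpace.toDual ℝ (Vec n)).symm.continuous.measurable.comp (measurable_fderiv ℝ d)

lemma measurable_bregman (hd : Differentiable ℝ d) (u : Vec n) :
    Measurable fun z => bregman d z u := by
  have := measurable_gradient d
  have := hd.continuous.measurable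
  unfold bregman
  fun_prop

/-- The error term is Young's inequality `R s - s² / 2 ≤ R² / 2` at the length `s` of the step,
where the quadratic comes from strong convexity. -/
lemma bregman_mirrorInv_le (hd : IsProxFunction p d) (h0 : 0 < p) (h2 : p ≤ 2) (z a u : Vec n)
    {R : ℝ} (hR : ∀ v, inner ℝ a v ≤ R * lpNorm p v) :
    bregman d (mirrorInv d (gradient d z - a)) u
      ≤ bregman d z u - inner ℝ a (z - u) + 1 / 2 * R ^ 2 := by
  set y := mirrorInv d (gradient d z - a)
  have hgrad : gradient d y = gradient d z - a := gradient_mirrorInv hd h0 h2 _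
  have hthree : bregman d y u = bregman d z u - bregman d z y - inner ℝ a (z - u)
      + inner ℝ a (z - y) := by
    simp only [bregman, hgrad, inner_sub_left, inner_sub_right]
    ring
  have hsymm : lpNorm p (z - y) = lpNorm p (y - z) := by simp [lpNorm, abs_sub_comm]
  have hstep := hR (z - y)
  rw [hsymm] at hstep
  linarith [half_lpNorm_sq_le_bregman hd z y, sq_nonneg (R - lpNorm p (y - z)),
    sub_sq R (lpNorm p (y - z))]

end MirrorStep

section Objective

variable {n : ℕ}

lemma inner_eq_sum (x y : Vec n) : inner ℝ x y = ∑ i, x i * y i := by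
  simp [PiLp.inner_apply, mul_comm]

lemma inner_single (x : Vec n) (i : Fin n) : inner ℝ x (EuclideanSpace.single i 1) = x i := by
  simp [EuclideanSpace.inner_single_right]

lemma abs_sub_sub_inner_gradient_le {φ : Vec n → ℝ} (hφ : Differentiable ℝ φ) {K : ℝ} (hK : 0 ≤ K)
    (hlip : ∀ x y, ‖gradient φ x - gradient φ y‖ ≤ K * ‖x - y‖) (x y : Vec n) :
    |φ y - φ x - inner ℝ (gradient φ x) (y - x)| ≤ K * ‖y - x‖ ^ 2 := by
  have hderiv (z) (hz : z ∈ segment ℝ x y) : ‖fderiv ℝ φ z - fderiv ℝ φ x‖ ≤ K * ‖y - x‖ :=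
    calc ‖fderiv ℝ φ z - fderiv ℝ φ x‖ = ‖gradient φ z - gradient φ x‖ := by
          rw [gradient, gradient, ← map_sub, LinearIsometryEquiv.norm_map]
      _ ≤ K * ‖z - x‖ := hlip z x
      _ ≤ K * ‖y - x‖ := by
          gcongr
          exact norm_sub_le_of_mem_segment hz
  have := (convex_segment x y).norm_image_sub_le_of_norm_fderiv_le' (fun z _ => hφ z) hderiv
    (left_mem_segment ℝ x y) (right_mem_segment ℝ x y)
  rwa [inner_gradient, ← Real.norm_eq_abs, sq, ← mul_assoc]

lemma sub_le_inner_gradient_of_convexOn {φ : Vec n → ℝ} (hφ : Differentiable ℝ φ)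
    (hc : ConvexOn ℝ Set.univ φ) (x y : Vec n) :
    φ x - φ y ≤ inner ℝ (gradient φ x) (x - y) := by
  have hder := (hφ (AffineMap.lineMap x y (0 : ℝ))).hasFDerivAt.comp_hasDerivAt (0 : ℝ)
    AffineMap.hasDerivAt_lineMap
  have hslope := (hc.comp_affineMap (AffineMap.lineMap x y)).le_slope_of_hasDerivAt trivial trivial
    zero_lt_one hder
  rw [slope_def_field, Function.comp_apply, Function.comp_apply, AffineMap.lineMap_apply_zero,
    AffineMap.lineMap_apply_one, sub_zero, div_one, ← inner_gradient, ← neg_sub x y,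
    inner_neg_right] at hslope
  linarith

variable {𝒳 : Type*} [MeasurableSpace 𝒳] {P : Measure 𝒳}
  {F : Vec n → 𝒳 → ℝ} {L : 𝒳 → ℝ} {σ : ℝ}

lemma ae_lipConst_nonneg [NeZero n] (hF : IsSmoothStochasticProblem P F L σ) :
    ∀ᵐ ξ ∂P, 0 ≤ L ξ := by
  filter_upwards [hF.lipschitz] with ξ h
  have := (norm_nonneg _).trans (h (EuclideanSpace.single 0 1) 0)
  rwa [sub_zero, PiLp.norm_single, norm_one, mul_one] at this

lemma ae_abs_sub_sub_inner_gradient_le [NeZero n] (hF : IsSmoothStochasticProblem P F L σ) :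
    ∀ᵐ ξ ∂P, ∀ x y, |F y ξ - F x ξ - inner ℝ (gradient (fun u => F u ξ) x) (y - x)|
      ≤ L ξ * ‖y - x‖ ^ 2 := by
  filter_upwards [ae_lipConst_nonneg hF, hF.differentiable, hF.lipschitz] with ξ h0 h1 h2 x y
  exact abs_sub_sub_inner_gradient_le h1 h0 h2 x y

lemma measurable_apply (hF : IsSmoothStochasticProblem P F L σ) (x : Vec n) : Measurable (F x) :=
  hF.measurable.comp measurable_prodMk_left

lemma aestronglyMeasurable_partial (hF : IsSmoothStochasticProblem P F L σ) (x : Vec n)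
    (i : Fin n) : AEStronglyMeasurable (fun ξ => gradient (fun u => F u ξ) x i) P := by
  refine aestronglyMeasurable_of_tendsto_ae Filter.atTop
    (f := fun (k : ℕ) ξ => ((k : ℝ) + 1) *
      (F (x + ((k : ℝ) + 1)⁻¹ • EuclideanSpace.single i 1) ξ - F x ξ)) (fun k => ?_) ?_
  · exact (((measurable_apply hF _).sub (measurable_apply hF _)).const_mul _).aestronglyMeasurable
  · filter_upwards [hF.differentiable] with ξ hξ
    rw [← inner_single, inner_gradient]
    refine (hξ x).hasFDerivAt.lim (EuclideanSpace.single i 1) (c := fun k : ℕ => (k : ℝ) + 1) ?_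
    refine Filter.tendsto_atTop_mono (fun k => le_abs_self _) ?_
    exact Filter.tendsto_atTop_add_const_right _ _ tendsto_natCast_atTop_atTop

lemma memLp_partial_sub (hF : IsSmoothStochasticProblem P F L σ) (x : Vec n)
    (i : Fin n) :
    MemLp (fun ξ => gradient (fun u => F u ξ) x i - gradient (objective P F) x i) 2 P := by
  have hmeas : AEStronglyMeasurable
      (fun ξ => gradient (fun u => F u ξ) x i - gradient (objective P F) x i) P :=
    (aestronglyMeasurable_partial hF x i).sub aestronglyMeasurable_const
  rw [memLp_two_iff_integrable_sq hmeas]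
  refine Integrable.mono' (hF.variance_integrable x) (hmeas.pow 2) (ae_of_all _ fun ξ => ?_)
  rw [norm_pow]
  gcongr
  exact PiLp.norm_apply_le (gradient (fun u => F u ξ) x - gradient (objective P F) x) i

lemma memLp_partial [IsFiniteMeasure P] (hF : IsSmoothStochasticProblem P F L σ) (x : Vec n)
    (i : Fin n) : MemLp (fun ξ => gradient (fun u => F u ξ) x i) 2 P :=
  ((memLp_partial_sub hF x i).add (memLp_const (gradient (objective P F) x i))).ae_eq
    (ae_of_all _ fun _ => sub_add_cancel _ _)

lemma smoothConst_sq : smoothConst P L ^ 2 = ∫ ξ, L ξ ^ 2 ∂P := by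
  rw [smoothConst, Real.sq_sqrt (integral_nonneg fun _ => sq_nonneg _)]

lemma integral_le_smoothConst [IsProbabilityMeasure P] (hL : MemLp L 2 P) :
    ∫ ξ, L ξ ∂P ≤ smoothConst P L := by
  refine Real.le_sqrt_of_sq_le ?_
  have := variance_nonneg L P
  rwa [variance_eq_sub hL, sub_nonneg] at this

lemma integrable_partial [IsFiniteMeasure P] [NeZero n] (hF : IsSmoothStochasticProblem P F L σ)
    (x : Vec n) (i : Fin n) : Integrable (fun ξ => gradient (fun u => F u ξ) x i) P := by
  refine Integrable.mono' (((hF.integrable (x + EuclideanSpace.single i 1)).sub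
    (hF.integrable x)).abs.add (hF.memLp.integrable one_le_two))
    (aestronglyMeasurable_partial hF x i) ?_
  filter_upwards [ae_abs_sub_sub_inner_gradient_le hF] with ξ h
  have := h x (x + EuclideanSpace.single i 1)
  rw [add_sub_cancel_left, inner_single, PiLp.norm_single, norm_one, one_pow, mul_one] at this
  rw [Real.norm_eq_abs, abs_sub_comm] at *
  simp only [Pi.add_apply, Pi.sub_apply]
  linarith [abs_sub_abs_le_abs_sub (gradient (fun u => F u ξ) x i)
    (F (x + EuclideanSpace.single i 1) ξ - F x ξ)]

/-- The vector of the expected partial derivatives; it turns out to be the gradient of the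
objective, but is defined before the objective is known to be differentiable. -/
def meanGradient (P : Measure 𝒳) (F : Vec n → 𝒳 → ℝ) (x : Vec n) : Vec n :=
  WithLp.toLp 2 fun i => ∫ ξ, gradient (fun u => F u ξ) x i ∂P

lemma integrable_inner_gradient [IsFiniteMeasure P] [NeZero n]
    (hF : IsSmoothStochasticProblem P F L σ) (x v : Vec n) :
    Integrable (fun ξ => inner ℝ (gradient (fun u => F u ξ) x) v) P := by
  simp only [inner_eq_sum]
  exact integrable_finsetSum _ fun i _ => (integrable_partial hF x i).mul_const _

lemma inner_meanGradient [IsFiniteMeasure P] [NeZero n]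
    (hF : IsSmoothStochasticProblem P F L σ) (x v : Vec n) :
    inner ℝ (meanGradient P F x) v = ∫ ξ, inner ℝ (gradient (fun u => F u ξ) x) v ∂P := by
  simp_rw [inner_eq_sum]
  rw [integral_finsetSum _ fun i _ => (integrable_partial hF x i).mul_const _]
  simp_rw [integral_mul_const]
  rfl

variable [IsProbabilityMeasure P]

lemma abs_objective_sub_sub_inner_meanGradient_le [NeZero n]
    (hF : IsSmoothStochasticProblem P F L σ) (x y : Vec n) :
    |objective P F y - objective P F x - inner ℝ (meanGradient P F x) (y - x)|
      ≤ smoothConst P L * ‖y - x‖ ^ 2 := by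
  have hsub : Integrable (fun ξ => F y ξ - F x ξ) P := (hF.integrable y).sub (hF.integrable x)
  have hinner := integrable_inner_gradient hF x (y - x)
  rw [objective, objective, inner_meanGradient hF,
    ← integral_sub (hF.integrable y) (hF.integrable x), ← integral_sub hsub hinner]
  calc _ ≤ ∫ ξ, |F y ξ - F x ξ - inner ℝ (gradient (fun u => F u ξ) x) (y - x)| ∂P :=
        abs_integral_le_integral_abs
    _ ≤ ∫ ξ, L ξ * ‖y - x‖ ^ 2 ∂P := by
        refine integral_mono_ae (hsub.sub hinner).abs
          ((hF.memLp.integrable one_le_two).mul_const _) ?_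
        filter_upwards [ae_abs_sub_sub_inner_gradient_le hF] with ξ h using h x y
    _ ≤ _ := by
        rw [integral_mul_const]
        exact mul_le_mul_of_nonneg_right (integral_le_smoothConst hF.memLp) (sq_nonneg _)

lemma hasFDerivAt_objective [NeZero n] (hF : IsSmoothStochasticProblem P F L σ) (x : Vec n) :
    HasFDerivAt (objective P F) (innerSL ℝ (meanGradient P F x)) x := by
  refine HasFDerivAt.of_isLittleO ?_
  refine Asymptotics.IsBigO.trans_isLittleO (g := fun y => ‖y - x‖ ^ 2) ?_
    (Asymptotics.isLittleO_pow_sub_sub x one_lt_two)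
  refine Asymptotics.IsBigO.of_bound (smoothConst P L) (Filter.Eventually.of_forall fun y => ?_)
  simpa using abs_objective_sub_sub_inner_meanGradient_le hF x y

lemma gradient_objective [NeZero n] (hF : IsSmoothStochasticProblem P F L σ) (x : Vec n) :
    gradient (objective P F) x = meanGradient P F x := by
  refine ext_inner_right ℝ fun v => ?_
  rw [inner_gradient, (hasFDerivAt_objective hF x).fderiv, innerSL_apply_apply]

lemma differentiable_objective [NeZero n] (hF : IsSmoothStochasticProblem P F L σ) :
    Differentiable ℝ (objective P F) := fun x => (hasFDerivAt_objective hF x).differentiableAt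

/-- Compare the minimum with the value after a gradient step of length `1 / (2 L₂)`. -/
lemma norm_gradient_objective_sq_le [NeZero n] (hF : IsSmoothStochasticProblem P F L σ)
    (hL : 0 < smoothConst P L) {xs : Vec n} (hxs : ∀ x, objective P F xs ≤ objective P F x)
    (x : Vec n) : ‖gradient (objective P F) x‖ ^ 2
      ≤ 4 * smoothConst P L * (objective P F x - objective P F xs) := by
  set K := smoothConst P L
  set g := gradient (objective P F) x with hg
  have hstep :=
    le_of_abs_le (abs_objective_sub_sub_inner_meanGradient_le hF x (x - (1 / (2 * K)) • g))
  rw [← gradient_objective hF, ← hg, sub_sub_cancel_left, norm_neg, norm_smul, inner_neg_right,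
    inner_smul_right, real_inner_self_eq_norm_sq, Real.norm_of_nonneg (by positivity)] at hstep
  have hval : K * (1 / (2 * K) * ‖g‖) ^ 2 - 1 / (2 * K) * ‖g‖ ^ 2 = -(‖g‖ ^ 2 / (4 * K)) := by
    field_simp
    ring
  have hdecrease : ‖g‖ ^ 2 / (4 * K) ≤ objective P F x - objective P F xs := by
    linarith [hxs (x - (1 / (2 * K)) • g)]
  rwa [div_le_iff₀' (by positivity)] at hdecrease

lemma sum_variance_partial_le [NeZero n] (hF : IsSmoothStochasticProblem P F L σ) (x : Vec n) :
    ∑ i, Var[fun ξ => gradient (fun u => F u ξ) x i; P] ≤ σ ^ 2 := by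
  refine le_trans (le_of_eq ?_) (hF.variance_le x)
  have hmean (i) : ∫ ξ, gradient (fun u => F u ξ) x i ∂P = gradient (objective P F) x i := by
    rw [gradient_objective hF, meanGradient]
  simp_rw [EuclideanSpace.norm_sq_eq, PiLp.sub_apply, Real.norm_eq_abs, sq_abs]
  rw [integral_finsetSum _ fun i _ => (memLp_partial_sub hF x i).integrable_sq]
  refine Finset.sum_congr rfl fun i _ => ?_
  rw [variance_eq_integral (aestronglyMeasurable_partial hF x i).aemeasurable, hmean]

end Objective

section Batch

variable {𝒳 : Type*} {n m : ℕ}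

/-- The average of `h` over the batch `ξ`, the building block of the mini-batch estimators. -/
def batchMean (h : 𝒳 → ℝ) (ξ : Fin m → 𝒳) : ℝ := 1 / (m : ℝ) * ∑ k, h (ξ k)

lemma gradEst_eq (fn : Vec n → 𝒳 → ℝ) (t : ℝ) (x e : Vec n) (ξ : Fin m → 𝒳) :
    gradEst fn t x e ξ = (batchMean (fun ζ => (fn (x + t • e) ζ - fn x ζ) / t) ξ • e, m) := by
  simp only [gradEst, oracleDiff, Prod.fst_sum, Prod.snd_sum, batchMean, ← Finset.sum_smul,
    smul_smul]
  simp

lemma batchMean_sub (h h' : 𝒳 → ℝ) (ξ : Fin m → 𝒳) :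
    batchMean h ξ - batchMean h' ξ = batchMean (fun ζ => h ζ - h' ζ) ξ := by
  simp only [batchMean, Finset.sum_sub_distrib, mul_sub]

lemma batchMean_mono {h h' : 𝒳 → ℝ} {ξ : Fin m → 𝒳} (hle : ∀ k, h (ξ k) ≤ h' (ξ k)) :
    batchMean h ξ ≤ batchMean h' ξ :=
  mul_le_mul_of_nonneg_left (Finset.sum_le_sum fun k _ => hle k) (by positivity)

lemma batchMean_const_mul_add_const [NeZero m] (a b : ℝ) (h : 𝒳 → ℝ) (ξ : Fin m → 𝒳) :
    batchMean (fun ζ => a * h ζ + b) ξ = a * batchMean h ξ + b := by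
  have : (m : ℝ) ≠ 0 := NeZero.ne _
  simp only [batchMean, Finset.sum_add_distrib, ← Finset.mul_sum, Finset.sum_const,
    Finset.card_univ, Fintype.card_fin, nsmul_eq_mul]
  field_simp

lemma batchMean_sq_le [NeZero m] (h : 𝒳 → ℝ) (ξ : Fin m → 𝒳) :
    batchMean h ξ ^ 2 ≤ batchMean (fun ζ => h ζ ^ 2) ξ := by
  have : (m : ℝ) ≠ 0 := NeZero.ne _
  calc batchMean h ξ ^ 2 ≤ (1 / (m : ℝ)) ^ 2 * (m * ∑ k, h (ξ k) ^ 2) := by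
        rw [batchMean, mul_pow]
        gcongr
        simpa using sq_sum_le_card_mul_sum_sq (s := Finset.univ) (f := fun k => h (ξ k))
    _ = batchMean (fun ζ => h ζ ^ 2) ξ := by
        rw [batchMean]
        field_simp

variable [MeasurableSpace 𝒳] {P : Measure 𝒳} [IsProbabilityMeasure P] {h : 𝒳 → ℝ}

lemma integrable_batchMean (hh : Integrable h P) :
    Integrable (batchMean h) (Measure.pi fun _ : Fin m => P) :=
  (integrable_finsetSum _ fun _ _ => integrable_comp_eval hh).const_mul _

lemma integral_batchMean [NeZero m] (hh : Integrable h P) :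
    ∫ ξ, batchMean h ξ ∂(Measure.pi fun _ : Fin m => P) = ∫ ζ, h ζ ∂P := by
  have : (m : ℝ) ≠ 0 := NeZero.ne _
  simp only [batchMean]
  rw [integral_const_mul, integral_finsetSum _ fun _ _ => integrable_comp_eval hh,
    Finset.sum_congr rfl fun _ _ => integral_comp_eval hh.aestronglyMeasurable]
  simp [this]

lemma memLp_batchMean (hh : MemLp h 2 P) :
    MemLp (batchMean h) 2 (Measure.pi fun _ : Fin m => P) :=
  (memLp_finsetSum _ fun k _ =>
    hh.comp_measurePreserving (measurePreserving_eval (fun _ : Fin m => P) k)).const_mul _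

lemma variance_batchMean [NeZero m] (hh : MemLp h 2 P) :
    Var[batchMean h; Measure.pi fun _ : Fin m => P] = Var[h; P] / m := by
  have : (m : ℝ) ≠ 0 := NeZero.ne _
  have hsum : (batchMean h : (Fin m → 𝒳) → ℝ)
      = fun ξ => 1 / (m : ℝ) * (∑ k, fun ξ : Fin m → 𝒳 => h (ξ k)) ξ := by
    ext ξ
    simp [batchMean]
  rw [hsum, variance_const_mul, variance_sum_pi fun _ => hh, Finset.sum_const, Finset.card_univ,
    Fintype.card_fin, nsmul_eq_mul]
  field_simp

lemma integral_batchMean_sq [NeZero m] (hh : MemLp h 2 P) :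
    ∫ ξ, batchMean h ξ ^ 2 ∂(Measure.pi fun _ : Fin m => P)
      = (∫ ζ, h ζ ∂P) ^ 2 + Var[h; P] / m := by
  have := variance_eq_sub (memLp_batchMean (m := m) hh)
  rw [integral_batchMean (hh.integrable one_le_two), variance_batchMean hh] at this
  simp only [Pi.pow_apply] at this
  linarith

end Batch

section QuadraticForm

variable {n : ℕ}

lemma inner_mul_inner_mul_eq_sum (u w e : Vec n) (c : ℝ) :
    inner ℝ u e * inner ℝ w e * c = ∑ i, ∑ j, e i * e j * c * (u i * w j) := by
  rw [inner_eq_sum, inner_eq_sum, Finset.sum_mul_sum]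
  simp only [Finset.sum_mul]
  exact Finset.sum_congr rfl fun i _ => Finset.sum_congr rfl fun j _ => by ring

variable [NeZero n] {Y : Type*} [MeasurableSpace Y] {ν : Measure Y} {φ : Vec n → ℝ}
  {u w : Y → Vec n}

lemma integrable_coord_mul_coord_mul_prod (hφc : Continuous φ) {a : Y → ℝ} (ha : Integrable a ν)
    (i j : Fin n) :
    Integrable (fun z : Vec n × Y => z.1 i * z.1 j * φ z.1 * a z.2) ((sphereUniform n).prod ν) :=
  (integrable_sphereUniform_of_continuous (φ := fun e => e i * e j * φ e)
    (by fun_prop)).mul_prod ha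

lemma integrable_inner_mul_inner_mul (hφc : Continuous φ)
    (huw : ∀ i j, Integrable (fun y => u y i * w y j) ν) :
    Integrable (fun z : Vec n × Y => inner ℝ (u z.2) z.1 * inner ℝ (w z.2) z.1 * φ z.1)
      ((sphereUniform n).prod ν) := by
  simp_rw [inner_mul_inner_mul_eq_sum]
  exact integrable_finsetSum _ fun i _ => integrable_finsetSum _ fun j _ =>
    integrable_coord_mul_coord_mul_prod hφc (huw i j) i j

lemma integral_inner_mul_inner_mul [SFinite ν] (hφ : IsSymmetricFn φ) (hφc : Continuous φ)
    (huw : ∀ i j, Integrable (fun y => u y i * w y j) ν) :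
    ∫ z : Vec n × Y, inner ℝ (u z.2) z.1 * inner ℝ (w z.2) z.1 * φ z.1 ∂((sphereUniform n).prod ν)
      = (∫ e, φ e ∂(sphereUniform n)) / n * ∑ i, ∫ y, u y i * w y i ∂ν := by
  have hint (i j) := integrable_coord_mul_coord_mul_prod hφc (huw i j) i j
  have hterm (i j) : ∫ z : Vec n × Y, z.1 i * z.1 j * φ z.1 * (u z.2 i * w z.2 j)
        ∂((sphereUniform n).prod ν)
      = if i = j then (∫ e, φ e ∂(sphereUniform n)) / n * ∫ y, u y i * w y j ∂ν else 0 := by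
    rw [integral_prod_mul (fun e : Vec n => e i * e j * φ e) (fun y => u y i * w y j),
      integral_coord_mul_coord hφ hφc, ite_mul, zero_mul]
  simp_rw [inner_mul_inner_mul_eq_sum]
  rw [integral_finsetSum _ fun i _ => integrable_finsetSum _ fun j _ => hint i j, Finset.mul_sum]
  refine Finset.sum_congr rfl fun i _ => ?_
  rw [integral_finsetSum _ fun j _ => hint i j]
  simp only [hterm, Finset.sum_ite_eq, Finset.mem_univ, if_true]

lemma integrable_inner_mul_inner (huw : ∀ i j, Integrable (fun y => u y i * w y j) ν) :
    Integrable (fun z : Vec n × Y => inner ℝ (u z.2) z.1 * inner ℝ (w z.2) z.1)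
      ((sphereUniform n).prod ν) := by
  simpa using integrable_inner_mul_inner_mul (φ := fun _ => 1) continuous_const huw

lemma integral_inner_mul_inner [SFinite ν]
    (huw : ∀ i j, Integrable (fun y => u y i * w y j) ν) :
    ∫ z : Vec n × Y, inner ℝ (u z.2) z.1 * inner ℝ (w z.2) z.1 ∂((sphereUniform n).prod ν)
      = (∑ i, ∫ y, u y i * w y i ∂ν) / n := by
  simpa [div_eq_inv_mul] using
    integral_inner_mul_inner_mul (isSymmetricFn_const 1) continuous_const huw

end QuadraticForm

section Estimator

variable {𝒳 : Type*} {n m : ℕ}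

/-- The mini-batch average of the exact stochastic gradients at `x`. -/
def batchGradient (F : Vec n → 𝒳 → ℝ) (x : Vec n) (ξ : Fin m → 𝒳) : Vec n :=
  WithLp.toLp 2 fun i => batchMean (fun ζ => gradient (fun u => F u ζ) x i) ξ

/-- The bound for the squared error of the finite differences with step `t` and noise level `Δ`,
as estimates of directional derivatives. -/
def diffErrorBound (L : 𝒳 → ℝ) (t Δ : ℝ) (ξ : Fin m → 𝒳) : ℝ :=
  2 * t ^ 2 * batchMean (fun ζ => L ζ ^ 2) ξ + 8 * Δ ^ 2 / t ^ 2

lemma inner_batchGradient (F : Vec n → 𝒳 → ℝ) (x e : Vec n) (ξ : Fin m → 𝒳) :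
    inner ℝ (batchGradient F x ξ) e
      = batchMean (fun ζ => inner ℝ (gradient (fun u => F u ζ) x) e) ξ := by
  simp only [inner_eq_sum, batchGradient, batchMean, mul_assoc, ← Finset.mul_sum, Finset.sum_mul]
  rw [Finset.sum_comm]

lemma finiteDiff_sub_inner_sq_le {φ ψ : Vec n → ℝ} {K t Δ : ℝ} (ht : 0 < t) {x g e : Vec n}
    (he : ‖e‖ = 1) (hφ : ∀ y, |φ y - φ x - inner ℝ g (y - x)| ≤ K * ‖y - x‖ ^ 2)
    (hψ : ∀ y, |ψ y| ≤ Δ) :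
    ((φ (x + t • e) + ψ (x + t • e) - (φ x + ψ x)) / t - inner ℝ g e) ^ 2
      ≤ 2 * t ^ 2 * K ^ 2 + 8 * Δ ^ 2 / t ^ 2 := by
  have htaylor := hφ (x + t • e)
  rw [add_sub_cancel_left, inner_smul_right, norm_smul, he, Real.norm_of_nonneg ht.le,
    mul_one] at htaylor
  set r := φ (x + t • e) - φ x - t * inner ℝ g e
  have herror : |r + ψ (x + t • e) - ψ x| ≤ K * t ^ 2 + 2 * Δ := by
    calc _ ≤ |r| + |ψ (x + t • e)| + |ψ x| := (abs_sub _ _).trans (by gcongr; exact abs_add_le _ _)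
      _ ≤ K * t ^ 2 + Δ + Δ := by gcongr <;> apply hψ
      _ = _ := by ring
  calc _ = (r + ψ (x + t • e) - ψ x) ^ 2 / t ^ 2 := by
        rw [← div_pow]
        congr 1
        field_simp
        ring
    _ ≤ (K * t ^ 2 + 2 * Δ) ^ 2 / t ^ 2 := by
        gcongr ?_ / _
        exact sq_le_sq' (abs_le.1 herror).1 (abs_le.1 herror).2
    _ ≤ 2 * ((K * t ^ 2) ^ 2 + (2 * Δ) ^ 2) / t ^ 2 := by
        gcongr
        exact add_sq_le
    _ = _ := by field_simp; ring

lemma batchMean_finiteDiff_sub_inner_sq_le [NeZero m] {F η : Vec n → 𝒳 → ℝ} {L : 𝒳 → ℝ} {t Δ : ℝ}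
    (ht : 0 < t) {x e : Vec n} {ξ : Fin m → 𝒳} (he : ‖e‖ = 1)
    (hF : ∀ k y, |F y (ξ k) - F x (ξ k) - inner ℝ (gradient (fun u => F u (ξ k)) x) (y - x)|
      ≤ L (ξ k) * ‖y - x‖ ^ 2)
    (hη : ∀ k y, |η y (ξ k)| ≤ Δ) :
    (batchMean (fun ζ => (F (x + t • e) ζ + η (x + t • e) ζ - (F x ζ + η x ζ)) / t) ξ
      - inner ℝ (batchGradient F x ξ) e) ^ 2 ≤ diffErrorBound L t Δ ξ := by
  rw [inner_batchGradient, batchMean_sub, diffErrorBound, ← batchMean_const_mul_add_const]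
  refine (batchMean_sq_le _ _).trans (batchMean_mono fun k => ?_)
  exact finiteDiff_sub_inner_sq_le (φ := (F · (ξ k))) (ψ := (η · (ξ k))) ht he (hF k) (hη k)

variable [MeasurableSpace 𝒳] {P : Measure 𝒳} [IsProbabilityMeasure P] {F : Vec n → 𝒳 → ℝ}
  {L : 𝒳 → ℝ} {σ : ℝ}

lemma integrable_diffErrorBound (hL : MemLp L 2 P) (t Δ : ℝ) :
    Integrable (diffErrorBound L t Δ) (Measure.pi fun _ : Fin m => P) :=
  ((integrable_batchMean hL.integrable_sq).const_mul _).add (integrable_const _)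

/-- The choice of `t` balances the Taylor error of order `t² L₂²` and the noise error of order
`Δ² / t²`. -/
lemma integral_diffErrorBound [NeZero m] (hL : MemLp L 2 P) {t Δ : ℝ} (hpos : 0 < smoothConst P L)
    (hΔ : 0 < Δ) (ht : t = 2 * √(Δ / smoothConst P L)) :
    ∫ ξ, diffErrorBound L t Δ ξ ∂(Measure.pi fun _ : Fin m => P) = 10 * (Δ * smoothConst P L) := by
  have ht2 : t ^ 2 = 4 * (Δ / smoothConst P L) := by
    rw [ht, mul_pow, Real.sq_sqrt (by positivity)]
    norm_num
  simp only [diffErrorBound]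
  rw [integral_add ((integrable_batchMean hL.integrable_sq).const_mul _) (integrable_const _),
    integral_const_mul, integral_batchMean hL.integrable_sq, ← smoothConst_sq, integral_const,
    probReal_univ, one_smul, ht2]
  field_simp
  ring

lemma memLp_batchGradient_apply (hF : IsSmoothStochasticProblem P F L σ) (x : Vec n) (i : Fin n) :
    MemLp (fun ξ => batchGradient F x ξ i) 2 (Measure.pi fun _ : Fin m => P) :=
  memLp_batchMean (memLp_partial hF x i)

lemma integral_batchGradient_apply [NeZero n] [NeZero m] (hF : IsSmoothStochasticProblem P F L σ)
    (x : Vec n) (i : Fin n) :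
    ∫ ξ, batchGradient F x ξ i ∂(Measure.pi fun _ : Fin m => P)
      = gradient (objective P F) x i := by
  rw [gradient_objective hF]
  exact integral_batchMean (integrable_partial hF x i)

lemma sum_integral_batchGradient_mul_self_le [NeZero n] [NeZero m]
    (hF : IsSmoothStochasticProblem P F L σ) (x : Vec n) :
    ∑ i, ∫ ξ, batchGradient F x ξ i * batchGradient F x ξ i ∂(Measure.pi fun _ : Fin m => P)
      ≤ ‖gradient (objective P F) x‖ ^ 2 + σ ^ 2 / m := by
  have hsq (i) : ∫ ξ, batchGradient F x ξ i * batchGradient F x ξ i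
        ∂(Measure.pi fun _ : Fin m => P)
      = gradient (objective P F) x i ^ 2 + Var[fun ζ => gradient (fun u => F u ζ) x i; P] / m := by
    simp_rw [← sq]
    rw [gradient_objective hF]
    exact integral_batchMean_sq (memLp_partial hF x i)
  simp_rw [hsq, EuclideanSpace.norm_sq_eq, Real.norm_eq_abs, sq_abs]
  rw [Finset.sum_add_distrib, ← Finset.sum_div]
  gcongr
  exact sum_variance_partial_le hF x

lemma integrable_inner_batchGradient_mul_inner [NeZero n] (hF : IsSmoothStochasticProblem P F L σ)
    (x v : Vec n) :
    Integrable (fun z : Vec n × (Fin m → 𝒳) =>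
        inner ℝ (batchGradient F x z.2) z.1 * inner ℝ v z.1)
      ((sphereUniform n).prod (Measure.pi fun _ : Fin m => P)) :=
  integrable_inner_mul_inner (w := fun _ => v) fun i _ =>
    ((memLp_batchGradient_apply hF x i).integrable one_le_two).mul_const _

lemma integral_inner_batchGradient_mul_inner [NeZero n] [NeZero m]
    (hF : IsSmoothStochasticProblem P F L σ) (x v : Vec n) :
    ∫ z, inner ℝ (batchGradient F x z.2) z.1 * inner ℝ v z.1
        ∂((sphereUniform n).prod (Measure.pi fun _ : Fin m => P))
      = inner ℝ (gradient (objective P F) x) v / n := by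
  rw [integral_inner_mul_inner (w := fun _ => v) fun i _ =>
    ((memLp_batchGradient_apply hF x i).integrable one_le_two).mul_const _, inner_eq_sum]
  simp_rw [integral_mul_const, integral_batchGradient_apply hF]

lemma integrable_inner_batchGradient_sq_mul [NeZero n] (hF : IsSmoothStochasticProblem P F L σ)
    (x : Vec n) {φ : Vec n → ℝ} (hφc : Continuous φ) :
    Integrable (fun z : Vec n × (Fin m → 𝒳) => inner ℝ (batchGradient F x z.2) z.1
        * inner ℝ (batchGradient F x z.2) z.1 * φ z.1)
      ((sphereUniform n).prod (Measure.pi fun _ : Fin m => P)) :=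
  integrable_inner_mul_inner_mul hφc fun i j =>
    (memLp_batchGradient_apply hF x i).integrable_mul (memLp_batchGradient_apply hF x j)

lemma integral_inner_batchGradient_sq_mul_le [NeZero n] [NeZero m]
    (hF : IsSmoothStochasticProblem P F L σ) (x : Vec n) {φ : Vec n → ℝ} (hφ : IsSymmetricFn φ)
    (hφc : Continuous φ) (hφ0 : 0 ≤ φ) :
    ∫ z, inner ℝ (batchGradient F x z.2) z.1 * inner ℝ (batchGradient F x z.2) z.1 * φ z.1
        ∂((sphereUniform n).prod (Measure.pi fun _ : Fin m => P))
      ≤ (∫ e, φ e ∂(sphereUniform n)) / n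
        * (‖gradient (objective P F) x‖ ^ 2 + σ ^ 2 / m) := by
  rw [integral_inner_mul_inner_mul hφ hφc fun i j =>
    (memLp_batchGradient_apply hF x i).integrable_mul (memLp_batchGradient_apply hF x j)]
  have := integral_nonneg (μ := sphereUniform n) hφ0
  gcongr
  exact sum_integral_batchGradient_mul_self_le hF x

end Estimator

section OneStep

variable {𝒳 : Type*} {n m : ℕ} {p : ℝ} {d : Vec n → ℝ}

/-- The iteration map of the method: one step from `x`, with direction `z.1` and batch `z.2`,
written with the mirror map in place of the minimization. -/
def mirrorStep (d : Vec n → ℝ) (fn : Vec n → 𝒳 → ℝ) (α t : ℝ) (x : Vec n)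
    (z : Vec n × (Fin m → 𝒳)) : Vec n :=
  mirrorInv d (gradient d x - (α * n) • (gradEst fn t x z.1 z.2).1)

/-- The bound for the Bregman divergence from the next iterate to `u`, where `W` is the divergence
from the current iterate `x`, `v = x - u`, `g` is a gradient estimate at `x`, `Z` bounds the squared
error of the directional derivative along `e`, and `Q` is the dual norm of `e`. The free parameter
`lam` distributes the effect of that error. -/
def stepBound (n : ℕ) (α lam W : ℝ) (v g e : Vec n) (Z Q : ℝ) : ℝ :=
  W - α * n * (inner ℝ g e * inner ℝ v e)
    + α * n * (Z / (2 * lam) + lam / 2 * (inner ℝ v e * inner ℝ v e))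
    + (α * n) ^ 2 * (inner ℝ g e * inner ℝ g e * Q ^ 2 + Q ^ 2 * Z)

/-- The error a step adds to the expected Bregman divergence, relative to the step size, due to the
batch variance and to the oracle noise; `lam` is the parameter of `stepBound`. -/
def stepError (n m : ℕ) (σ Δ L₂ lam : ℝ) : ℝ :=
  σ ^ 2 / (12 * L₂ * m) + 5 / 6 * (n * Δ) + 5 * n * Δ * L₂ / lam

lemma neg_mul_le_of_sq_le {a b c r : ℝ} (hr : 0 < r) (h : a ^ 2 ≤ c) :
    -(a * b) ≤ c / (2 * r) + r / 2 * (b * b) := by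
  have : 0 ≤ (a + r * b) ^ 2 / (2 * r) := by positivity
  calc -(a * b) ≤ -(a * b) + (a + r * b) ^ 2 / (2 * r) := le_add_of_nonneg_right this
    _ = a ^ 2 / (2 * r) + r / 2 * (b * b) := by field_simp; ring
    _ ≤ c / (2 * r) + r / 2 * (b * b) := by gcongr

lemma bregman_mirrorInv_le_stepBound (hd : IsProxFunction p d) (hn : 8 ≤ n) (h1 : 1 ≤ p)
    (h2 : p ≤ 2) {α lam s Z : ℝ} (hα : 0 ≤ α) (hlam : 0 < lam) (x u g e : Vec n)
    (hs : (s - inner ℝ g e) ^ 2 ≤ Z) :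
    bregman d (mirrorInv d (gradient d x - (α * n) • (s • e))) u
      ≤ stepBound n α lam (bregman d x u) (x - u) g e Z (lpNorm (dualExp p n) e) := by
  set Q := lpNorm (dualExp p n) e
  have hr := two_le_dualExp hn h1 h2
  have hdual (v) : inner ℝ ((α * n) • (s • e)) v ≤ α * n * |s| * Q * lpNorm p v := by
    rw [smul_smul]
    refine (inner_le_lpNorm_dualExp_mul_lpNorm hn h1 h2 _ v).trans_eq ?_
    rw [lpNorm_smul (by linarith), abs_mul, abs_of_nonneg (by positivity : 0 ≤ α * n)]
  refine (bregman_mirrorInv_le hd (by linarith) h2 x _ u hdual).trans ?_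
  set a := inner ℝ g e
  set b := inner ℝ (x - u) e with hb
  have hlinear : inner ℝ ((α * n) • (s • e)) (x - u)
      = α * n * (a * b) - α * n * (-((s - a) * b)) := by
    rw [real_inner_smul_left, real_inner_smul_left, real_inner_comm, ← hb]
    ring
  have hsquare : 1 / 2 * (α * n * |s| * Q) ^ 2 ≤ (α * n) ^ 2 * (a * a * Q ^ 2 + Q ^ 2 * Z) := by
    have hs2 : 1 / 2 * s ^ 2 ≤ a * a + Z := by linarith [add_sq_le (a := a) (b := s - a)]
    calc 1 / 2 * (α * n * |s| * Q) ^ 2 = (α * n) ^ 2 * Q ^ 2 * (1 / 2 * s ^ 2) := by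
          rw [← sq_abs s]
          ring
      _ ≤ (α * n) ^ 2 * Q ^ 2 * (a * a + Z) := by gcongr
      _ = _ := by ring
  have hyoung : α * n * (-((s - a) * b)) ≤ α * n * (Z / (2 * lam) + lam / 2 * (b * b)) := by
    gcongr
    exact neg_mul_le_of_sq_le hlam hs
  rw [hlinear, stepBound]
  linarith

variable [MeasurableSpace 𝒳] {P : Measure 𝒳} [IsProbabilityMeasure P]
  {F η : Vec n → 𝒳 → ℝ} {L : 𝒳 → ℝ} {σ : ℝ}

lemma ae_prod_pi_forall_of_ae {E : Type*} [MeasurableSpace E] {ν : Measure E} {q : 𝒳 → Prop}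
    (h : ∀ᵐ ζ ∂P, q ζ) :
    ∀ᵐ z ∂(ν.prod (Measure.pi fun _ : Fin m => P)), ∀ k, q (z.2 k) := by
  have hpi : ∀ᵐ ξ ∂(Measure.pi fun _ : Fin m => P), ∀ k, q (ξ k) := ae_all_iff.2 fun k =>
    (measurePreserving_eval (fun _ : Fin m => P) k).quasiMeasurePreserving.ae h
  exact Measure.quasiMeasurePreserving_snd.ae hpi

lemma ae_bregman_mirrorStep_le [NeZero m] (hd : IsProxFunction p d) (hn : 8 ≤ n) (h1 : 1 ≤ p)
    (h2 : p ≤ 2) (hF : IsSmoothStochasticProblem P F L σ) {Δ t α lam : ℝ}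
    (hη : IsBoundedNoise P η Δ) (ht : 0 < t) (hα : 0 ≤ α) (hlam : 0 < lam) (x u : Vec n) :
    ∀ᵐ z ∂((sphereUniform n).prod (Measure.pi fun _ : Fin m => P)),
      bregman d (mirrorStep d (fun x z => F x z + η x z) α t x z) u
      ≤ stepBound n α lam (bregman d x u) (x - u) (batchGradient F x z.2) z.1
        (diffErrorBound L t Δ z.2) (lpNorm (dualExp p n) z.1) := by
  have : NeZero n := ⟨by omega⟩
  have hsphere : ∀ᵐ z ∂((sphereUniform n).prod (Measure.pi fun _ : Fin m => P)), ‖z.1‖ = 1 :=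
    Measure.quasiMeasurePreserving_fst.ae ae_norm_eq_one_sphereUniform
  filter_upwards [hsphere, ae_prod_pi_forall_of_ae (ae_abs_sub_sub_inner_gradient_le hF),
    ae_prod_pi_forall_of_ae hη.bound] with z hz1 hzF hzη
  rw [mirrorStep, gradEst_eq]
  exact bregman_mirrorInv_le_stepBound hd hn h1 h2 hα hlam x u _ _
    (batchMean_finiteDiff_sub_inner_sq_le ht hz1 (fun k => hzF k x) hzη)

lemma integrable_inner_mul_inner_fst [NeZero n] (v : Vec n) :
    Integrable (fun z : Vec n × (Fin m → 𝒳) => inner ℝ v z.1 * inner ℝ v z.1)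
      ((sphereUniform n).prod (Measure.pi fun _ : Fin m => P)) :=
  integrable_inner_mul_inner (u := fun _ => v) (w := fun _ => v) fun _ _ => integrable_const _

lemma integral_inner_mul_inner_fst [NeZero n] (v : Vec n) :
    ∫ z, inner ℝ v z.1 * inner ℝ v z.1
        ∂((sphereUniform n).prod (Measure.pi fun _ : Fin m => P)) = ‖v‖ ^ 2 / n := by
  rw [integral_inner_mul_inner (u := fun _ => v) (w := fun _ => v) fun _ _ => integrable_const _,
    ← real_inner_self_eq_norm_sq, inner_eq_sum]
  simp

lemma integrable_stepBound [NeZero n] (hF : IsSmoothStochasticProblem P F L σ)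
    {r : ℝ} (hr : 0 < r) (α lam W t Δ : ℝ) (v x : Vec n) :
    Integrable (fun z : Vec n × (Fin m → 𝒳) => stepBound n α lam W v (batchGradient F x z.2) z.1
        (diffErrorBound L t Δ z.2) (lpNorm r z.1))
      ((sphereUniform n).prod (Measure.pi fun _ : Fin m => P)) := by
  have hQ : Continuous fun e : Vec n => lpNorm r e ^ 2 := (continuous_lpNorm hr).pow 2
  have hZ := integrable_diffErrorBound (m := m) hF.memLp t Δ
  exact (((integrable_const W).sub
    ((integrable_inner_batchGradient_mul_inner hF x v).const_mul _)).add
    (((hZ.comp_snd _).div_const _).add ((integrable_inner_mul_inner_fst v).const_mul _)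
      |>.const_mul _)).add
    (((integrable_inner_batchGradient_sq_mul hF x hQ).add
      ((integrable_sphereUniform_of_continuous hQ).mul_prod hZ)).const_mul _)

lemma integral_stepBound_le [NeZero n] [NeZero m] (hF : IsSmoothStochasticProblem P F L σ)
    {r : ℝ} (hr : 0 < r) (α lam W t Δ : ℝ) (v x : Vec n) :
    ∫ z, stepBound n α lam W v (batchGradient F x z.2) z.1 (diffErrorBound L t Δ z.2)
        (lpNorm r z.1) ∂((sphereUniform n).prod (Measure.pi fun _ : Fin m => P))
      ≤ W - α * inner ℝ (gradient (objective P F) x) v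
        + α * n * ((∫ ξ, diffErrorBound L t Δ ξ ∂(Measure.pi fun _ : Fin m => P)) / (2 * lam)
          + lam / 2 * (‖v‖ ^ 2 / n))
        + (α * n) ^ 2 * ((∫ e, lpNorm r e ^ 2 ∂(sphereUniform n)) / n
            * (‖gradient (objective P F) x‖ ^ 2 + σ ^ 2 / m)
          + (∫ e, lpNorm r e ^ 2 ∂(sphereUniform n))
            * ∫ ξ, diffErrorBound L t Δ ξ ∂(Measure.pi fun _ : Fin m => P)) := by
  have hn : (n : ℝ) ≠ 0 := NeZero.ne _
  have hQ : Continuous fun e : Vec n => lpNorm r e ^ 2 := (continuous_lpNorm hr).pow 2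
  have hZ := integrable_diffErrorBound (m := m) hF.memLp t Δ
  have hlin := (integrable_inner_batchGradient_mul_inner (m := m) hF x v).const_mul (α * n)
  have herr := (hZ.comp_snd (sphereUniform n)).div_const (2 * lam)
  have hdist := (integrable_inner_mul_inner_fst (m := m) (P := P) v).const_mul (lam / 2)
  have hgrad := integrable_inner_batchGradient_sq_mul (m := m) hF x hQ
  have hnoise := (integrable_sphereUniform_of_continuous hQ).mul_prod hZ
  simp only [stepBound]
  rw [integral_add (by exact ((integrable_const W).sub hlin).add ((herr.add hdist).const_mul _))
      (by exact (hgrad.add hnoise).const_mul _),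
    integral_add (by exact (integrable_const W).sub hlin) (by exact (herr.add hdist).const_mul _),
    integral_sub (integrable_const W) hlin, integral_const_mul, integral_const_mul,
    integral_const_mul, integral_add herr hdist, integral_add hgrad hnoise, integral_div,
    integral_const_mul, integral_fun_snd, integral_prod_mul (fun e : Vec n => lpNorm r e ^ 2),
    integral_inner_batchGradient_mul_inner hF, integral_inner_mul_inner_fst, integral_const,
    probReal_univ, probReal_univ, one_smul, one_smul, mul_assoc α, mul_div_cancel₀ _ hn]
  gcongr
  exact integral_inner_batchGradient_sq_mul_le hF x (isSymmetricFn_lpNorm_sq r) hQ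
    fun _ => sq_nonneg _

lemma step_variance_le {ρ L₂ α D Q S Δ : ℝ} (hn : 0 < n) (hρ : 0 < ρ) (hL₂ : 0 < L₂)
    (hα : α = 1 / (48 * n * ρ * L₂)) (hD : 0 ≤ D) (hS : 0 ≤ S) (hΔ : 0 ≤ Δ) (hQ : Q ≤ 4 * ρ) :
    (α * n) ^ 2 * (Q / n * (4 * L₂ * D + S) + Q * (10 * (Δ * L₂)))
      ≤ α / 2 * D + α * (S / (12 * L₂) + 5 / 6 * (n * Δ)) := by
  have : (0 : ℝ) < n := Nat.cast_pos.2 hn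
  have hα0 : 0 < α := by rw [hα]; positivity
  have hstep : 48 * n * ρ * L₂ * α = 1 := by rw [hα]; field_simp
  calc _ ≤ (α * n) ^ 2 * (4 * ρ / n * (4 * L₂ * D + S) + 4 * ρ * (10 * (Δ * L₂))) := by gcongr
    _ = α * (48 * n * ρ * L₂ * α) * ((4 * L₂ * D + S) / (12 * L₂) + 5 / 6 * (n * Δ)) := by
        field_simp
        ring
    _ = α / 3 * D + α * (S / (12 * L₂) + 5 / 6 * (n * Δ)) := by
        rw [hstep]
        field_simp
        ring
    _ ≤ _ := by gcongr; norm_num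

lemma lintegral_ofReal_le_ofReal_integral {E : Type*} [MeasurableSpace E] {ν : Measure E}
    {f g : E → ℝ} (hf : 0 ≤ f) (hfg : f ≤ᵐ[ν] g) (hg : Integrable g ν) :
    ∫⁻ z, ENNReal.ofReal (f z) ∂ν ≤ ENNReal.ofReal (∫ z, g z ∂ν) := by
  rw [ofReal_integral_eq_lintegral_ofReal hg (hfg.mono fun z hz => (hf z).trans hz)]
  exact lintegral_mono_ae (hfg.mono fun _ => ENNReal.ofReal_le_ofReal)

lemma integral_stepBound_add_le [NeZero m] (hd : IsProxFunction p d) (hn : 8 ≤ n)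
    (h1 : 1 ≤ p) (h2 : p ≤ 2) (hF : IsSmoothStochasticProblem P F L σ) {Δ t α lam : ℝ}
    (hL : 0 < smoothConst P L) (hΔ : 0 < Δ) (ht : t = 2 * √(Δ / smoothConst P L))
    (hα : α = 1 / (48 * n * rho p n * smoothConst P L)) (hlam : 0 < lam)
    {xs : Vec n} (hxs : ∀ x, objective P F xs ≤ objective P F x) (x : Vec n) :
    ∫ z, stepBound n α lam (bregman d x xs) (x - xs) (batchGradient F x z.2) z.1
        (diffErrorBound L t Δ z.2) (lpNorm (dualExp p n) z.1)
        ∂((sphereUniform n).prod (Measure.pi fun _ : Fin m => P))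
      + α / 2 * (objective P F x - objective P F xs)
    ≤ (1 + α * lam) * bregman d x xs + α * stepError n m σ Δ (smoothConst P L) lam := by
  have : NeZero n := ⟨by omega⟩
  have : (0 : ℝ) < n := Nat.cast_pos.2 (NeZero.pos n)
  have hρ := rho_pos hn h1 h2
  have hα0 : 0 < α := by rw [hα]; positivity
  have hr := two_le_dualExp hn h1 h2
  have hbound := integral_stepBound_le (m := m) hF (r := dualExp p n) (by linarith)
    α lam (bregman d x xs) t Δ (x - xs) x
  rw [integral_diffErrorBound hF.memLp hL hΔ ht] at hbound
  set L₂ := smoothConst P L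
  set D := objective P F x - objective P F xs
  set Q := ∫ e, lpNorm (dualExp p n) e ^ 2 ∂(sphereUniform n)
  have hconvex : D ≤ inner ℝ (gradient (objective P F) x) (x - xs) :=
    sub_le_inner_gradient_of_convexOn (differentiable_objective hF) hF.convex x xs
  have hdist : ‖x - xs‖ ^ 2 ≤ 2 * bregman d x xs := by
    rw [norm_sub_rev]
    linarith [half_norm_sq_le_bregman hd (by linarith) h2 x xs]
  have herror : α * n * (10 * (Δ * L₂) / (2 * lam) + lam / 2 * (‖x - xs‖ ^ 2 / n))
      ≤ α * (5 * n * Δ * L₂ / lam) + α * lam * bregman d x xs := by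
    calc _ = α * (5 * n * Δ * L₂ / lam) + α * lam / 2 * ‖x - xs‖ ^ 2 := by field_simp; ring
      _ ≤ α * (5 * n * Δ * L₂ / lam) + α * lam / 2 * (2 * bregman d x xs) := by gcongr
      _ = _ := by ring
  have hvariance : (α * n) ^ 2 * (Q / n * (‖gradient (objective P F) x‖ ^ 2 + σ ^ 2 / m)
        + Q * (10 * (Δ * L₂)))
      ≤ α / 2 * D + α * (σ ^ 2 / (12 * L₂ * m) + 5 / 6 * (n * Δ)) := by
    have : 0 ≤ Q := integral_nonneg fun _ => sq_nonneg _
    calc _ ≤ (α * n) ^ 2 * (Q / n * (4 * L₂ * D + σ ^ 2 / m) + Q * (10 * (Δ * L₂))) := by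
          gcongr
          exact norm_gradient_objective_sq_le hF hL hxs x
      _ ≤ α / 2 * D + α * (σ ^ 2 / m / (12 * L₂) + 5 / 6 * (n * Δ)) :=
          step_variance_le (NeZero.pos n) hρ hL hα (sub_nonneg.2 (hxs x)) (by positivity) hΔ.le
            (integral_lpNorm_dualExp_sq_le hn h1 h2)
      _ = _ := by rw [div_div, mul_comm (m : ℝ)]
  rw [stepError]
  linarith [mul_le_mul_of_nonneg_left hconvex hα0.le]

lemma lintegral_bregman_mirrorStep_add_le [NeZero m] (hd : IsProxFunction p d) (hn : 8 ≤ n)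
    (h1 : 1 ≤ p) (h2 : p ≤ 2) (hF : IsSmoothStochasticProblem P F L σ) {Δ t α lam : ℝ}
    (hL : 0 < smoothConst P L) (hη : IsBoundedNoise P η Δ) (hΔ : 0 < Δ)
    (ht : t = 2 * √(Δ / smoothConst P L))
    (hα : α = 1 / (48 * n * rho p n * smoothConst P L)) (hlam : 0 < lam)
    {xs : Vec n} (hxs : ∀ x, objective P F xs ≤ objective P F x) (x : Vec n) :
    (∫⁻ z, ENNReal.ofReal (bregman d (mirrorStep d (fun x z => F x z + η x z) α t x z) xs)
        ∂((sphereUniform n).prod (Measure.pi fun _ : Fin m => P)))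
      + ENNReal.ofReal (α / 2 * (objective P F x - objective P F xs))
    ≤ ENNReal.ofReal ((1 + α * lam) * bregman d x xs
        + α * stepError n m σ Δ (smoothConst P L) lam) := by
  have : NeZero n := ⟨by omega⟩
  have hρ := rho_pos hn h1 h2
  have hα0 : 0 ≤ α := by rw [hα]; positivity
  have ht0 : 0 < t := by rw [ht]; positivity
  have hr := two_le_dualExp hn h1 h2
  have hstep := ae_bregman_mirrorStep_le (m := m) hd hn h1 h2 hF hη ht0 hα0 hlam x xs
  refine (add_le_add_left (lintegral_ofReal_le_ofReal_integral (fun _ => bregman_nonneg hd _ _)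
    hstep (integrable_stepBound hF (by linarith) _ _ _ _ _ _ _)) _).trans ?_
  rw [← ENNReal.ofReal_add
    (integral_nonneg_of_ae (hstep.mono fun _ hz => (bregman_nonneg hd _ _).trans hz))
    (mul_nonneg (by positivity) (sub_nonneg.2 (hxs x)))]
  exact ENNReal.ofReal_le_ofReal
    (integral_stepBound_add_le hd hn h1 h2 hF hL hΔ ht hα hlam hxs x)

end OneStep

section RandomRecursion

variable {Ω S E : Type*} [MeasurableSpace S] [MeasurableSpace E]
  {Z : ℕ → Ω → S} {X : ℕ → Ω → E} {step : E → S → E} {x₀ : E}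

lemma exists_measurable_of_recursion (hstep : Measurable (Function.uncurry step))
    (h0 : ∀ ω, X 0 ω = x₀) (hs : ∀ k ω, X (k + 1) ω = step (X k ω) (Z k ω)) (k : ℕ) :
    ∃ Ψ : (Finset.range k → S) → E, Measurable Ψ ∧ ∀ ω, X k ω = Ψ fun i => Z i ω := by
  induction k with
  | zero => exact ⟨fun _ => x₀, measurable_const, h0⟩
  | succ k ih =>
    obtain ⟨Ψ, hΨ, hX⟩ := ih
    refine ⟨fun w => step (Ψ fun i => w ⟨i, Finset.mem_range.2
      ((Finset.mem_range.1 i.2).trans k.lt_succ_self)⟩) (w ⟨k, Finset.self_mem_range_succ k⟩),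
      ?_, fun ω => ?_⟩
    · exact hstep.comp ((hΨ.comp (measurable_pi_lambda _ fun i => measurable_pi_apply _)).prodMk
        (measurable_pi_apply _))
    · rw [hs, hX]

variable [MeasurableSpace Ω] {μ : Measure Ω}

lemma aemeasurable_of_recursion (hstep : Measurable (Function.uncurry step))
    (hZ : ∀ k, AEMeasurable (Z k) μ) (h0 : ∀ ω, X 0 ω = x₀)
    (hs : ∀ k ω, X (k + 1) ω = step (X k ω) (Z k ω)) (k : ℕ) : AEMeasurable (X k) μ := by
  obtain ⟨Ψ, hΨ, hX⟩ := exists_measurable_of_recursion hstep h0 hs k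
  rw [funext hX]
  exact hΨ.comp_aemeasurable (aemeasurable_pi_lambda _ fun i => hZ i)

lemma indepFun_of_recursion (hstep : Measurable (Function.uncurry step))
    (hZ : ∀ k, AEMeasurable (Z k) μ) (hi : iIndepFun Z μ) (h0 : ∀ ω, X 0 ω = x₀)
    (hs : ∀ k ω, X (k + 1) ω = step (X k ω) (Z k ω)) (k : ℕ) : IndepFun (X k) (Z k) μ := by
  obtain ⟨Ψ, hΨ, hX⟩ := exists_measurable_of_recursion hstep h0 hs k
  have hpast := hi.indepFun_finset₀ (Finset.range k) {k} (by simp) hZ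
  rw [funext hX]
  exact hpast.comp hΨ
    (measurable_pi_apply (⟨k, Finset.mem_singleton_self k⟩ : ({k} : Finset ℕ)))

variable [IsProbabilityMeasure μ] {ν : Measure S} [IsProbabilityMeasure ν]

lemma lintegral_recursion_succ (hstep : Measurable (Function.uncurry step))
    (hZ : ∀ k, HasLaw (Z k) ν μ) (hi : iIndepFun Z μ) (h0 : ∀ ω, X 0 ω = x₀)
    (hs : ∀ k ω, X (k + 1) ω = step (X k ω) (Z k ω)) {φ : E → ENNReal} (hφ : Measurable φ)
    (k : ℕ) : ∫⁻ ω, φ (X (k + 1) ω) ∂μ = ∫⁻ ω, ∫⁻ z, φ (step (X k ω) z) ∂ν ∂μ := by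
  have hZm (k) : AEMeasurable (Z k) μ := (hZ k).aemeasurable
  have hXm := aemeasurable_of_recursion hstep hZm h0 hs k
  have hmap := (indepFun_iff_map_prod_eq_prod_map_map hXm (hZm k)).1
    (indepFun_of_recursion hstep hZm hi h0 hs k)
  have hφs : Measurable fun q : E × S => φ (step q.1 q.2) := hφ.comp hstep
  simp_rw [hs]
  calc ∫⁻ ω, φ (step (X k ω) (Z k ω)) ∂μ
      = ∫⁻ q, φ (step q.1 q.2) ∂(μ.map fun ω => (X k ω, Z k ω)) := by
        rw [lintegral_map' hφs.aemeasurable (hXm.prodMk (hZm k))]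
    _ = ∫⁻ x, ∫⁻ z, φ (step x z) ∂ν ∂(μ.map (X k)) := by
        rw [hmap, (hZ k).map_eq, lintegral_prod _ hφs.aemeasurable]
    _ = _ := by
        rw [lintegral_map' (Measurable.lintegral_prod_right' hφs).aemeasurable hXm]

lemma add_sum_le_of_linear_recursion {v w : ℕ → ENNReal} {A b : ENNReal} (hA : 1 ≤ A)
    (h : ∀ k, v (k + 1) + w k ≤ A * v k + b) (K : ℕ) :
    v K + ∑ k ∈ Finset.range K, w k ≤ A ^ K * (v 0 + K * b) := by
  induction K with
  | zero => simp
  | succ K ih =>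
    rw [Finset.sum_range_succ]
    calc v (K + 1) + (∑ k ∈ Finset.range K, w k + w K)
        = (v (K + 1) + w K) + ∑ k ∈ Finset.range K, w k := by ring
      _ ≤ (A * v K + b) + A * ∑ k ∈ Finset.range K, w k :=
          add_le_add (h K) (le_mul_of_one_le_left zero_le hA)
      _ = A * (v K + ∑ k ∈ Finset.range K, w k) + 1 * b := by ring
      _ ≤ A * (A ^ K * (v 0 + K * b)) + A ^ (K + 1) * b := by
          gcongr
          exact one_le_pow₀ hA
      _ = _ := by push_cast; ring

lemma sum_lintegral_le_of_drift (hstep : Measurable (Function.uncurry step))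
    (hZ : ∀ k, HasLaw (Z k) ν μ) (hi : iIndepFun Z μ) (h0 : ∀ ω, X 0 ω = x₀)
    (hs : ∀ k ω, X (k + 1) ω = step (X k ω) (Z k ω)) {φ ψ : E → ENNReal} (hφ : Measurable φ)
    (hψ : Measurable ψ) {A b : ENNReal} (hA : 1 ≤ A)
    (hdrift : ∀ x, ∫⁻ z, φ (step x z) ∂ν + ψ x ≤ A * φ x + b) (K : ℕ) :
    ∑ k ∈ Finset.range K, ∫⁻ ω, ψ (X k ω) ∂μ ≤ A ^ K * (φ x₀ + K * b) := by
  have hX := aemeasurable_of_recursion hstep (fun k => (hZ k).aemeasurable) h0 hs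
  have hφX (k) : AEMeasurable (fun ω => φ (X k ω)) μ := hφ.comp_aemeasurable (hX k)
  have hψX (k) : AEMeasurable (fun ω => ψ (X k ω)) μ := hψ.comp_aemeasurable (hX k)
  have hrec (k) : ∫⁻ ω, φ (X (k + 1) ω) ∂μ + ∫⁻ ω, ψ (X k ω) ∂μ
      ≤ A * ∫⁻ ω, φ (X k ω) ∂μ + b := by
    calc _ = ∫⁻ ω, (∫⁻ z, φ (step (X k ω) z) ∂ν + ψ (X k ω)) ∂μ := by
          rw [lintegral_recursion_succ hstep hZ hi h0 hs hφ,
            lintegral_add_right' _ (hψX k)]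
      _ ≤ ∫⁻ ω, (A * φ (X k ω) + b) ∂μ := lintegral_mono fun ω => hdrift (X k ω)
      _ = _ := by
          rw [lintegral_add_right _ measurable_const, lintegral_const_mul'' _ (hφX k),
            lintegral_const, measure_univ, mul_one]
  have hsum := add_sum_le_of_linear_recursion hA hrec K
  simp only [h0, lintegral_const, measure_univ, mul_one] at hsum
  exact le_add_self.trans hsum

end RandomRecursion

section Average

variable {Ω : Type*} [MeasurableSpace Ω] {μ : Measure Ω}

lemma integrable_and_integral_le_of_lintegral_ofReal_le {g : Ω → ℝ} {M : ℝ}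
    (hg : AEStronglyMeasurable g μ) (h0 : 0 ≤ g) (hM : 0 ≤ M)
    (h : ∫⁻ ω, ENNReal.ofReal (g ω) ∂μ ≤ ENNReal.ofReal M) :
    Integrable g μ ∧ ∫ ω, g ω ∂μ ≤ M := by
  have h0' : 0 ≤ᵐ[μ] g := ae_of_all _ h0
  refine ⟨(lintegral_ofReal_ne_top_iff_integrable hg h0').1
    (h.trans_lt ENNReal.ofReal_lt_top).ne, ?_⟩
  rw [integral_eq_lintegral_of_nonneg_ae h0' hg]
  exact ENNReal.toReal_le_of_le_ofReal hM h

lemma lintegral_ofReal_average_le {E : Type*} [AddCommGroup E] [Module ℝ E] [MeasurableSpace E]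
    {f : E → ℝ} (hf : ConvexOn ℝ Set.univ f) (hfm : Measurable f) (hf0 : 0 ≤ f)
    {X : ℕ → Ω → E} (hX : ∀ k, AEMeasurable (X k) μ) {N : ℕ} (hN : 0 < N) :
    ∫⁻ ω, ENNReal.ofReal (f ((1 / (N : ℝ)) • ∑ k ∈ Finset.range N, X k ω)) ∂μ
      ≤ ENNReal.ofReal (1 / N) * ∑ k ∈ Finset.range N, ∫⁻ ω, ENNReal.ofReal (f (X k ω)) ∂μ := by
  have hN0 : (N : ℝ) ≠ 0 := by positivity
  have hfX (k) : AEMeasurable (fun ω => f (X k ω)) μ := hfm.comp_aemeasurable (hX k)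
  have hjensen (ω) : f ((1 / (N : ℝ)) • ∑ k ∈ Finset.range N, X k ω)
      ≤ 1 / N * ∑ k ∈ Finset.range N, f (X k ω) := by
    rw [Finset.smul_sum, Finset.mul_sum]
    exact hf.map_sum_le (fun _ _ => by positivity) (by simp [hN0]) fun _ _ => trivial
  rw [← lintegral_finsetSum' _ fun k _ => (hfX k).ennreal_ofReal,
    ← lintegral_const_mul' _ _ ENNReal.ofReal_ne_top]
  refine lintegral_mono fun ω => ?_
  rw [← ENNReal.ofReal_sum_of_nonneg fun k _ => hf0 _, ← ENNReal.ofReal_mul (by positivity)]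
  exact ENNReal.ofReal_le_ofReal (hjensen ω)

lemma integrable_and_integral_average_sub_le [IsProbabilityMeasure μ] {E : Type*} [AddCommGroup E]
    [Module ℝ E] [MeasurableSpace E] [MeasurableAdd₂ E] [MeasurableConstSMul ℝ E] {f : E → ℝ}
    (hf : ConvexOn ℝ Set.univ f) (hfm : Measurable f) {X : ℕ → Ω → E}
    (hX : ∀ k, AEMeasurable (X k) μ) {N : ℕ} (hN : 0 < N) {a c M : ℝ} (ha : 0 < a)
    (hc : ∀ x, c ≤ f x) (hM : 0 ≤ M)
    (hsum : ∑ k ∈ Finset.range N, ∫⁻ ω, ENNReal.ofReal (a * (f (X k ω) - c)) ∂μ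
      ≤ ENNReal.ofReal M) :
    Integrable (fun ω => f ((1 / (N : ℝ)) • ∑ k ∈ Finset.range N, X k ω)) μ ∧
      ∫ ω, f ((1 / (N : ℝ)) • ∑ k ∈ Finset.range N, X k ω) ∂μ - c ≤ M / (N * a) := by
  set O : Ω → E := fun ω => (1 / (N : ℝ)) • ∑ k ∈ Finset.range N, X k ω
  have hO : AEMeasurable O μ := (Finset.aemeasurable_fun_sum _ fun k _ => hX k).fun_const_smul _
  have hgap0 : 0 ≤ fun x => a * (f x - c) := fun x => mul_nonneg ha.le (sub_nonneg.2 (hc x))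
  have hgapm : Measurable fun x => a * (f x - c) := (hfm.sub_const _).const_mul _
  have hgapc : ConvexOn ℝ Set.univ fun x => a * (f x - c) := by
    simp only [sub_eq_add_neg]
    exact (hf.add_const (-c)).smul ha.le
  have haverage : ∫⁻ ω, ENNReal.ofReal (a * (f (O ω) - c)) ∂μ ≤ ENNReal.ofReal (1 / N * M) := by
    rw [ENNReal.ofReal_mul (by positivity)]
    exact (lintegral_ofReal_average_le hgapc hgapm hgap0 hX hN).trans
      (mul_le_mul_right hsum _)
  obtain ⟨hint, hle⟩ := integrable_and_integral_le_of_lintegral_ofReal_le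
    (hgapm.comp_aemeasurable hO).aestronglyMeasurable (fun ω => hgap0 (O ω)) (by positivity)
    haverage
  have hfO : Integrable (fun ω => f (O ω)) μ := by
    refine ((hint.div_const a).add (integrable_const c)).congr (ae_of_all _ fun ω => ?_)
    simp only [Pi.add_apply, Function.comp_apply]
    field_simp
    ring
  have hlin : ∫ ω, a * (f (O ω) - c) ∂μ = a * (∫ ω, f (O ω) ∂μ - c) := by
    rw [integral_const_mul, integral_sub hfO (integrable_const _)]
    simp
  refine ⟨hfO, ?_⟩
  calc ∫ ω, f (O ω) ∂μ - c = (∫ ω, a * (f (O ω) - c) ∂μ) / a := by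
        rw [hlin]
        field_simp
    _ ≤ 1 / N * M / a := by gcongr; exact hle
    _ = M / (N * a) := by field_simp

end Average

section Method

variable {𝒳 : Type*} {n m : ℕ}

lemma rdfds_snd (d : Vec n → ℝ) (fn : Vec n → 𝒳 → ℝ) (α t : ℝ) (e : ℕ → Vec n)
    (ξ : ℕ → Fin m → 𝒳) (x₀ : Vec n) (k : ℕ) : (rdfds d fn α t e ξ x₀ k).2 = k * m := by
  induction k with
  | zero => simp [rdfds]
  | succ k ih => simp only [rdfds, ih, gradEst_eq]; ring

lemma rdfds_fst_succ (d : Vec n → ℝ) (fn : Vec n → 𝒳 → ℝ) (α t : ℝ) (e : ℕ → Vec n)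
    (ξ : ℕ → Fin m → 𝒳) (x₀ : Vec n) (k : ℕ) :
    (rdfds d fn α t e ξ x₀ (k + 1)).1
      = mirrorStep d fn α t (rdfds d fn α t e ξ x₀ k).1 (e k, ξ k) := by
  rw [mirrorStep, ← argminPt_eq_mirrorInv]
  simp only [rdfds, real_inner_smul_left]

variable [MeasurableSpace 𝒳]

lemma measurable_batchMean_finiteDiff {fn : Vec n → 𝒳 → ℝ}
    (hfn : Measurable (Function.uncurry fn)) (t : ℝ) :
    Measurable fun q : Vec n × (Vec n × (Fin m → 𝒳)) =>
      batchMean (fun ζ => (fn (q.1 + t • q.2.1) ζ - fn q.1 ζ) / t) q.2.2 := by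
  simp only [batchMean]
  refine (Finset.measurable_sum _ fun k _ => ?_).const_mul _
  have hξ : Measurable fun q : Vec n × (Vec n × (Fin m → 𝒳)) => q.2.2 k := by fun_prop
  have hx : Measurable fun q : Vec n × (Vec n × (Fin m → 𝒳)) => q.1 + t • q.2.1 := by fun_prop
  exact ((hfn.comp (hx.prodMk hξ)).sub (hfn.comp (measurable_fst.prodMk hξ))).div_const t

variable {p : ℝ} {d : Vec n → ℝ}

lemma measurable_mirrorStep (hd : IsProxFunction p d) (h0 : 0 < p) (h2 : p ≤ 2)
    {fn : Vec n → 𝒳 → ℝ} (hfn : Measurable (Function.uncurry fn)) (α t : ℝ) :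
    Measurable (Function.uncurry (mirrorStep (m := m) d fn α t)) := by
  refine (continuous_mirrorInv hd h0 h2).measurable.comp
    (((measurable_gradient d).comp measurable_fst).sub (Measurable.const_smul ?_ (α * n : ℝ)))
  simp only [gradEst_eq]
  exact (measurable_batchMean_finiteDiff hfn t).smul (measurable_fst.comp measurable_snd)

lemma one_add_inv_pow_le_three {N : ℕ} (hN : 0 < N) : (1 + 1 / (N : ℝ)) ^ N ≤ 3 := by
  calc (1 + 1 / (N : ℝ)) ^ N ≤ (Real.exp (1 / N)) ^ N := by
        gcongr
        linarith [Real.add_one_le_exp (1 / (N : ℝ))]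
    _ = Real.exp 1 := by rw [← Real.exp_nat_mul]; congr 1; field_simp
    _ ≤ 3 := by linarith [Real.exp_one_lt_d9]

variable {P : Measure 𝒳} [IsProbabilityMeasure P] {F η : Vec n → 𝒳 → ℝ} {L : 𝒳 → ℝ}
  {σ Δ t α : ℝ} {xs : Vec n} {Ω : Type*} [MeasurableSpace Ω] {μ : Measure Ω}
  {e : ℕ → Ω → Vec n} {ξ : ℕ → Ω → Fin m → 𝒳}

lemma aemeasurable_rdfds_fst (hd : IsProxFunction p d) (h0 : 0 < p) (h2 : p ≤ 2)
    {fn : Vec n → 𝒳 → ℝ} (hfn : Measurable (Function.uncurry fn)) (α t : ℝ)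
    (hs : IsSampling μ P e ξ) (x₀ : Vec n) (k : ℕ) :
    AEMeasurable (fun ω => (rdfds d fn α t (fun k => e k ω) (fun k => ξ k ω) x₀ k).1) μ :=
  aemeasurable_of_recursion
    (X := fun k ω => (rdfds d fn α t (fun k => e k ω) (fun k => ξ k ω) x₀ k).1)
    (measurable_mirrorStep hd h0 h2 hfn α t) (fun k => (hs.law k).aemeasurable) (fun _ => rfl)
    (fun k _ => rdfds_fst_succ d fn α t _ _ x₀ k) k

variable [IsProbabilityMeasure μ]

lemma sum_lintegral_gap_le [NeZero m] (hd : IsProxFunction p d) (hn : 8 ≤ n) (h1 : 1 ≤ p)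
    (h2 : p ≤ 2) (hF : IsSmoothStochasticProblem P F L σ) (hL : 0 < smoothConst P L)
    (hη : IsBoundedNoise P η Δ) (hΔ : 0 < Δ) (ht : t = 2 * √(Δ / smoothConst P L))
    (hα : α = 1 / (48 * n * rho p n * smoothConst P L))
    (hxs : ∀ x, objective P F xs ≤ objective P F x) (hs : IsSampling μ P e ξ) (x₀ : Vec n)
    {N : ℕ} (hN : 0 < N) :
    ∑ k ∈ Finset.range N, ∫⁻ ω, ENNReal.ofReal (α / 2 * (objective P F
        (rdfds d (fun x z => F x z + η x z) α t (fun k => e k ω) (fun k => ξ k ω) x₀ k).1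
          - objective P F xs)) ∂μ
      ≤ ENNReal.ofReal (3 * (bregman d x₀ xs
        + N * (α * stepError n m σ Δ (smoothConst P L) (1 / (α * N))))) := by
  have : (0 : ℝ) < n := by exact_mod_cast (by omega : 0 < n)
  have : NeZero n := ⟨by omega⟩
  have hρ := rho_pos hn h1 h2
  have hα0 : 0 < α := by rw [hα]; positivity
  have hΘ := bregman_nonneg hd x₀ xs
  set B := stepError n m σ Δ (smoothConst P L) (1 / (α * N)) with hB
  have hB0 : 0 ≤ B := by rw [hB, stepError]; positivity
  have hgap : Measurable fun x => ENNReal.ofReal (α / 2 * (objective P F x - objective P F xs)) :=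
    (((differentiable_objective hF).continuous.measurable.sub_const _).const_mul _).ennreal_ofReal
  have hdrift (x : Vec n) : (∫⁻ z, ENNReal.ofReal
        (bregman d (mirrorStep d (fun x z => F x z + η x z) α t x z) xs)
        ∂((sphereUniform n).prod (Measure.pi fun _ : Fin m => P)))
      + ENNReal.ofReal (α / 2 * (objective P F x - objective P F xs))
      ≤ ENNReal.ofReal (1 + 1 / N) * ENNReal.ofReal (bregman d x xs) + ENNReal.ofReal (α * B) := by
    have hlam : α * (1 / (α * N)) = 1 / N := by field_simp
    have hstep := lintegral_bregman_mirrorStep_add_le (m := m) hd hn h1 h2 hF hL hη hΔ ht hα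
      (lam := 1 / (α * N)) (by positivity) hxs x
    rwa [hlam, ENNReal.ofReal_add (mul_nonneg (by positivity) (bregman_nonneg hd _ _))
      (by positivity), ENNReal.ofReal_mul (by positivity : (0 : ℝ) ≤ 1 + 1 / N)] at hstep
  refine (sum_lintegral_le_of_drift
    (measurable_mirrorStep hd (by linarith) h2 (hF.measurable.add hη.measurable) α t) hs.law
    hs.indep (fun _ => rfl)
    (fun k ω => rdfds_fst_succ d _ α t (fun k => e k ω) (fun k => ξ k ω) x₀ k)
    (measurable_bregman hd.1 xs).ennreal_ofReal hgap
    (by rw [ENNReal.one_le_ofReal]; simp) hdrift N).trans ?_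
  rw [← ENNReal.ofReal_pow (by positivity), ← ENNReal.ofReal_natCast,
    ← ENNReal.ofReal_mul (by positivity), ← ENNReal.ofReal_add hΘ (by positivity),
    ← ENNReal.ofReal_mul (by positivity)]
  refine ENNReal.ofReal_le_ofReal ?_
  gcongr
  exact one_add_inv_pow_le_three hN

lemma integrable_and_integral_objective_rdfdsOutput_sub_le [NeZero m] (hd : IsProxFunction p d)
    (hn : 8 ≤ n) (h1 : 1 ≤ p) (h2 : p ≤ 2) (hF : IsSmoothStochasticProblem P F L σ)
    (hL : 0 < smoothConst P L) (hη : IsBoundedNoise P η Δ) (hΔ : 0 < Δ)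
    (ht : t = 2 * √(Δ / smoothConst P L)) (hα : α = 1 / (48 * n * rho p n * smoothConst P L))
    (hxs : ∀ x, objective P F xs ≤ objective P F x) (hs : IsSampling μ P e ξ) (x₀ : Vec n)
    {N : ℕ} (hN : 0 < N) :
    Integrable (fun ω => objective P F (rdfdsOutput d (fun x z => F x z + η x z) α t
        (fun k => e k ω) (fun k => ξ k ω) x₀ N)) μ ∧
      ∫ ω, objective P F (rdfdsOutput d (fun x z => F x z + η x z) α t
        (fun k => e k ω) (fun k => ξ k ω) x₀ N) ∂μ - objective P F xs
      ≤ 6 * (bregman d x₀ xs / (N * α)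
        + stepError n m σ Δ (smoothConst P L) (1 / (α * N))) := by
  have : (0 : ℝ) < n := by exact_mod_cast (by omega : 0 < n)
  have : NeZero n := ⟨by omega⟩
  have hρ := rho_pos hn h1 h2
  have hα0 : 0 < α := by rw [hα]; positivity
  have hΘ := bregman_nonneg hd x₀ xs
  have hB0 : 0 ≤ stepError n m σ Δ (smoothConst P L) (1 / (α * N)) := by
    rw [stepError]
    positivity
  have hX := aemeasurable_rdfds_fst (fn := fun x z => F x z + η x z) hd (by linarith) h2
    (hF.measurable.add hη.measurable) α t hs x₀
  obtain ⟨hint, hle⟩ := integrable_and_integral_average_sub_le hF.convex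
    (differentiable_objective hF).continuous.measurable hX hN (half_pos hα0) hxs (by positivity)
    (sum_lintegral_gap_le hd hn h1 h2 hF hL hη hΔ ht hα hxs hs x₀ hN)
  refine ⟨hint, hle.trans_eq ?_⟩
  field_simp
  ring

end Method

section Parameters

variable {C ε L₂ Δ Θ σ ρ α : ℝ} {n m N : ℕ}

lemma smoothing_le {c₁ t : ℝ} (hn : 0 < n) (hC : 2 ≤ C) (hc : c₁ ≤ 1) (hε : 0 < ε) (hL : 0 < L₂)
    (hΔ : 0 < Δ) (h1 : Δ ≤ c₁ * (ε / n)) (h2 : Δ * (n * L₂ * Θ) ≤ c₁ * ε ^ 2)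
    (ht : t = 2 * √(Δ / L₂)) :
    t ≤ C * √(ε / (n * L₂)) ∧ t * √(n * L₂ ^ 2 * Θ) ≤ C * ε := by
  have hsmall : Δ / L₂ ≤ ε / (n * L₂) := by
    rw [← div_div]
    gcongr
    exact h1.trans (mul_le_of_le_one_left (by positivity) hc)
  have hsqrt : √(Δ / L₂ * (n * L₂ ^ 2 * Θ)) ≤ ε := by
    calc √(Δ / L₂ * (n * L₂ ^ 2 * Θ)) = √(Δ * (n * L₂ * Θ)) := by congr 1; field_simp
      _ ≤ ε := (Real.sqrt_le_left hε.le).2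
          (h2.trans (mul_le_of_le_one_left (by positivity) hc))
  constructor
  · rw [ht]
    gcongr
  · rw [ht, mul_assoc, ← Real.sqrt_mul (by positivity)]
    gcongr

lemma distance_term_le (hn : 0 < n) (hρ : 0 < ρ) (hε : 0 < ε) (hL : 0 < L₂) (hN : 0 < N)
    (hN1 : 1152 * (n * ρ * L₂ * Θ / ε) ≤ N) (hα : α = 1 / (48 * n * ρ * L₂)) :
    Θ / (N * α) ≤ ε / 24 := by
  calc Θ / (N * α) = 48 * (n * ρ * L₂ * Θ / ε) * (ε / N) := by rw [hα]; field_simp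
    _ ≤ N / 24 * (ε / N) := by gcongr; linarith
    _ = ε / 24 := by field_simp

lemma variance_term_le (hε : 0 < ε) (hL : 0 < L₂) (hm : 0 < m)
    (hm1 : 1152 * (σ ^ 2 / (ε * L₂)) ≤ m) : σ ^ 2 / (12 * L₂ * m) ≤ ε / 24 := by
  have : 0 ≤ σ ^ 2 / (ε * L₂) := by positivity
  calc σ ^ 2 / (12 * L₂ * m) = 1 / 12 * (σ ^ 2 / (ε * L₂)) * (ε / m) := by field_simp
    _ ≤ m / 24 * (ε / m) := by gcongr; linarith
    _ = ε / 24 := by field_simp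

lemma noise_term_le (hn : 0 < n) (hC : 1 ≤ C) (hε : 0 < ε) (h1 : Δ ≤ 1 / (100 * C) * (ε / n)) :
    n * Δ ≤ ε / 100 := by
  calc n * Δ ≤ n * (1 / (100 * C) * (ε / n)) := by gcongr
    _ = ε / 100 / C := by field_simp
    _ ≤ ε / 100 := div_le_self (by positivity) hC

lemma drift_noise_term_le (hn : 0 < n) (hρ : 0 < ρ) (hnρ : 1 ≤ n * ρ) (hC : 0 < C) (hε : 0 < ε)
    (hL : 0 < L₂) (hΔ : 0 < Δ) (hN : N ≤ C * max 1 (n * ρ * L₂ * Θ / ε))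
    (h1 : Δ ≤ 1 / (100 * C) * (ε / n)) (h2 : Δ * (n * L₂ * Θ) ≤ 1 / (100 * C) * ε ^ 2)
    (hα : α = 1 / (48 * n * ρ * L₂)) : 5 * n * Δ * L₂ * (α * N) ≤ ε / 100 := by
  have hconst : C * (Δ / ρ) ≤ ε / 100 := by
    calc C * (Δ / ρ) ≤ C * (1 / (100 * C) * (ε / n) / ρ) := by gcongr
      _ = ε / 100 / (n * ρ) := by field_simp
      _ ≤ ε / 100 := div_le_self (by positivity) hnρ
  have hratio : C * (Δ / ρ) * (n * ρ * L₂ * Θ / ε) ≤ ε / 100 := by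
    calc _ = C * (Δ * (n * L₂ * Θ)) / ε := by field_simp
      _ ≤ C * (1 / (100 * C) * ε ^ 2) / ε := by gcongr
      _ = _ := by field_simp
  calc 5 * n * Δ * L₂ * (α * N) = 5 / 48 * (Δ / ρ * N) := by rw [hα]; field_simp
    _ ≤ 5 / 48 * (Δ / ρ * (C * max 1 (n * ρ * L₂ * Θ / ε))) := by gcongr
    _ = 5 / 48 * (C * (Δ / ρ) * max 1 (n * ρ * L₂ * Θ / ε)) := by ring
    _ = 5 / 48 * max (C * (Δ / ρ)) (C * (Δ / ρ) * (n * ρ * L₂ * Θ / ε)) := by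
        rw [mul_max_of_nonneg _ _ (by positivity), mul_one]
    _ ≤ 5 / 48 * (ε / 100) := by gcongr; exact max_le hconst hratio
    _ ≤ ε / 100 := by linarith

lemma rate_le (hn : 0 < n) (hρ : 0 < ρ) (hnρ : 1 ≤ n * ρ) (hC : 1 ≤ C) (hε : 0 < ε)
    (hL : 0 < L₂) (hΔ : 0 < Δ) (hN : 0 < N) (hm : 0 < m)
    (hN1 : 1152 * (n * ρ * L₂ * Θ / ε) ≤ N) (hN2 : N ≤ C * max 1 (n * ρ * L₂ * Θ / ε))
    (hm1 : 1152 * (σ ^ 2 / (ε * L₂)) ≤ m) (h1 : Δ ≤ 1 / (100 * C) * (ε / n))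
    (h2 : Δ * (n * L₂ * Θ) ≤ 1 / (100 * C) * ε ^ 2) (hα : α = 1 / (48 * n * ρ * L₂)) :
    6 * (Θ / (N * α) + stepError n m σ Δ L₂ (1 / (α * N))) ≤ ε := by
  have hdistance := distance_term_le hn hρ hε hL hN hN1 hα
  have hvariance := variance_term_le hε hL hm hm1
  have hnoise := noise_term_le hn hC hε h1
  have hdrift := drift_noise_term_le hn hρ hnρ (by linarith) hε hL hΔ hN2 h1 h2 hα
  rw [stepError, div_div_eq_mul_div, div_one]
  linarith

lemma calls_le (hC : 0 < C) (hN : N ≤ C * max 1 (n * ρ * L₂ * Θ / ε))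
    (hm : m ≤ C * max 1 (σ ^ 2 / (ε * L₂))) :
    (N * m : ℝ) ≤ C ^ 2 * (max 1 (n * ρ * L₂ * Θ / ε) * max 1 (σ ^ 2 / (ε * L₂))) := by
  calc (N * m : ℝ)
      ≤ (C * max 1 (n * ρ * L₂ * Θ / ε)) * (C * max 1 (σ ^ 2 / (ε * L₂))) := by gcongr
    _ = _ := by ring

lemma max_one_mul_max_one_eq (hε : 0 < ε) (hL : 0 < L₂) (h : ε ≤ n * ρ * L₂ * Θ) :
    max 1 (n * ρ * L₂ * Θ / ε) * max 1 (σ ^ 2 / (ε * L₂))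
      = max (n * ρ * L₂ * Θ / ε) (n * ρ * σ ^ 2 * Θ / ε ^ 2) := by
  have hy : 1 ≤ n * ρ * L₂ * Θ / ε := by rwa [le_div_iff₀ hε, one_mul]
  rw [max_eq_right hy, mul_max_of_nonneg _ _ (by linarith), mul_one]
  congr 1
  field_simp

lemma max_le_log_mul_max (hε : 0 < ε) (hL : 0 < L₂) (hΘ : 0 ≤ Θ) (hnρ : n * ρ ≤ 16 * Real.log n) :
    max (n * ρ * L₂ * Θ / ε) (n * ρ * σ ^ 2 * Θ / ε ^ 2)
      ≤ 16 * max (L₂ * Θ * Real.log n / ε) (σ ^ 2 * Θ * Real.log n / ε ^ 2) := by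
  calc max (n * ρ * L₂ * Θ / ε) (n * ρ * σ ^ 2 * Θ / ε ^ 2)
      ≤ max (16 * Real.log n * L₂ * Θ / ε) (16 * Real.log n * σ ^ 2 * Θ / ε ^ 2) := by gcongr
    _ = _ := by
        rw [mul_max_of_nonneg _ _ (by norm_num)]
        congr 1 <;> ring

end Parameters

end ZerothOrder

end

theorem corollary2 :
    (∀ n : ℕ, 8 ≤ n → IsProxFunction 1 (proxOne n)) ∧
    (∀ n : ℕ, 8 ≤ n → IsProxFunction 2 (proxTwo n)) ∧
    ∃ c₀ : ℝ, 0 < c₀ ∧ ∀ C : ℝ, c₀ ≤ C → ∃ c₁ : ℝ, 0 < c₁ ∧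
      ∀ (n : ℕ) (_ : 8 ≤ n) (p : ℝ) (_ : 1 ≤ p) (_ : p ≤ 2)
        (d : Vec n → ℝ) (_ : IsProxFunction p d)
        (𝒳 : Type*) [MeasurableSpace 𝒳] (P : Measure 𝒳) [IsProbabilityMeasure P]
        (F : Vec n → 𝒳 → ℝ) (L : 𝒳 → ℝ) (σ : ℝ) (_ : IsSmoothStochasticProblem P F L σ)
        (L₂ : ℝ) (_ : L₂ = smoothConst P L) (_ : 0 < L₂)
        (x₀ xs : Vec n) (_ : ∀ x, objective P F xs ≤ objective P F x)
        (Θ : ℝ) (_ : Θ = bregman d x₀ xs)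
        (ε : ℝ) (_ : 0 < ε)
        (N : ℕ) (_ : 1 ≤ N)
        (_ : c₀ * (n * rho p n * L₂ * Θ / ε) ≤ N)
        (_ : N ≤ C * max 1 (n * rho p n * L₂ * Θ / ε))
        (m : ℕ) (_ : 1 ≤ m) (_ : c₀ * (σ ^ 2 / (ε * L₂)) ≤ m)
        (_ : m ≤ C * max 1 (σ ^ 2 / (ε * L₂)))
        (Δ : ℝ) (_ : 0 < Δ) (_ : Δ ≤ c₁ * (ε / n)) (_ : Δ * (n * L₂ * Θ) ≤ c₁ * ε ^ 2)
        (η : Vec n → 𝒳 → ℝ) (_ : IsBoundedNoise P η Δ)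
        (t : ℝ) (_ : t = 2 * √(Δ / L₂))
        (α : ℝ) (_ : α = 1 / (48 * n * rho p n * L₂))
        (Ω : Type*) [MeasurableSpace Ω] (μ : Measure Ω) [IsProbabilityMeasure μ]
        (e : ℕ → Ω → Vec n) (ξ : ℕ → Ω → Fin m → 𝒳) (_ : IsSampling μ P e ξ),
        -- the smoothing parameter has the claimed order
        (t ≤ C * √(ε / (n * L₂)) ∧ t * √(n * L₂ ^ 2 * Θ) ≤ C * ε) ∧
        -- the output is an `ε`-solution in expectation
        (Integrable (fun ω => objective P F (rdfdsOutput d (fun x z => F x z + η x z) α t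
            (fun k => e k ω) (fun k => ξ k ω) x₀ N)) μ ∧
          ∫ ω, objective P F (rdfdsOutput d (fun x z => F x z + η x z) α t
            (fun k => e k ω) (fun k => ξ k ω) x₀ N) ∂μ - objective P F xs ≤ ε) ∧
        -- the number of oracle calls
        (∀ ω, ∀ T : ℕ, T = (rdfds d (fun x z => F x z + η x z) α t
            (fun k => e k ω) (fun k => ξ k ω) x₀ N).2 →
          T = N * m ∧
          T ≤ C ^ 2 * (max 1 (n * rho p n * L₂ * Θ / ε) * max 1 (σ ^ 2 / (ε * L₂))) ∧
          (ε ≤ n * rho p n * L₂ * Θ →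
            T ≤ C ^ 2 * max (n * rho p n * L₂ * Θ / ε) (n * rho p n * σ ^ 2 * Θ / ε ^ 2)) ∧
          (p = 1 → ε ≤ n * rho p n * L₂ * Θ →
            T ≤ 16 * C ^ 2 *
              max (L₂ * Θ * Real.log n / ε) (σ ^ 2 * Θ * Real.log n / ε ^ 2))) := by
  refine ⟨fun n hn => isProxFunction_proxOne hn, fun n _ => isProxFunction_proxTwo n,
    1152, by norm_num, fun C hC => ⟨1 / (100 * C), by positivity, ?_⟩⟩
  rintro n hn p h1 h2 d hd 𝒳 _ P _ F L σ hF _ rfl hL x₀ xs hxs _ rfl ε hε N hN hN1 hN2 m hm hm1 hm2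
    Δ hΔ hΔ1 hΔ2 η hη t ht α hα Ω _ μ _ e ξ hs
  have hn0 : 0 < n := by omega
  have hC0 : 0 < C := by linarith
  have : NeZero m := ⟨by omega⟩
  have hΘ := bregman_nonneg hd x₀ xs
  refine ⟨smoothing_le hn0 (by linarith) ((div_le_one (by positivity)).2 (by linarith)) hε hL hΔ
    hΔ1 hΔ2 ht, ?_, ?_⟩
  · obtain ⟨hint, hgap⟩ := integrable_and_integral_objective_rdfdsOutput_sub_le hd hn h1 h2 hF hL
      hη hΔ ht hα hxs hs x₀ hN
    exact ⟨hint, hgap.trans (rate_le hn0 (rho_pos hn h1 h2) (one_le_card_mul_rho hn h1 h2)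
      (by linarith) hε hL hΔ hN hm hN1 hN2 hm1 hΔ1 hΔ2 hα)⟩
  · rintro ω T rfl
    rw [rdfds_snd, Nat.cast_mul]
    have hcalls := calls_le hC0 hN2 hm2
    refine ⟨rfl, hcalls, fun h => ?_, fun hp h => ?_⟩ <;>
      rw [max_one_mul_max_one_eq hε hL h] at hcalls
    · exact hcalls
    · subst hp
      rw [mul_comm 16, mul_assoc]
      exact hcalls.trans (by gcongr; exact max_le_log_mul_max hε hL hΘ (card_mul_rho_one_le n))
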